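/- **Setting.** For a field $K$ and $u\in K$, $u\neq 0,1$, let $\mathbb A_u$ be the path algebra over $K$ of the quiver with vertices $k\in\mathbb Z_{\ge 0}$, arrows $d_+:k\to k+1$ and $d_-:k+1\to k$, and loops $T_1,\dots,T_{k-1}:k\to k$, modulo the relations (imposed at every vertex where the paths make sense; $k$ is the vertex where the paths begin) $$(T_i-1)(T_i+u)=0,\quad T_iT_{i+1}T_i=T_{i+1}T_iT_{i+1},\quad T_iT_j=T_jT_i\ (|i-j|>1),$$ $$d_-^2T_{k-1}=d_-^2,\quad T_id_-=d_-T_i\ (1\le i\le k-2),\quad T_1d_+^2=d_+^2,\quad d_+T_i=T_{i+1}d_+\ (1\le i\le k-1),$$ $$d_-(d_+d_--d_-d_+)T_{k-1}=u\,(d_+d_--d_-d_+)d_-\ (k\ge2),\qquad T_1(d_+d_--d_-d_+)d_+=u\,d_+(d_+d_--d_-d_+)\ (k\ge1).$$ Let $e_k$ be the idempotent of the vertex $k$. For $k\ge1$ define loops $y_1,\dots,y_k$ at $k$ by $y_1=\frac{1}{u^{k-1}(u-1)}(d_+d_--d_-d_+)T_{k-1}\cdots T_1$ and $y_{i+1}=u\,T_i^{-1}y_iT_i^{-1}$.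 We use $\mathbb A_q$ and $\mathbb A_{q^{-1}}$ over $\mathbb Q(q)$. Let $\operatorname{Sym}[X]=\mathbb Q(q,t)[p_1,p_2,\dots]$ be the ring of symmetric functions over $\mathbb Q(q,t)$, $V_k=\operatorname{Sym}[X]\otimes\mathbb Q(q,t)[y_1,\dots,y_k]$ and $V_*=\bigoplus_{k\ge0}V_k$. An *action* on $V_*$ is one by $\mathbb Q(q,t)$-linear operators in which $e_k$ acts as the projection onto $V_k$. *Basic operators.* With plethystic notation and $\operatorname{Exp}[X]=\exp\big(\sum_{n\ge1}p_n[X]/n\big)$, put for $F\in V_k$ $$T_iF=\frac{(q-1)y_iF+(y_{i+1}-qy_i)\operatorname{swap}_{y_i\leftrightarrow y_{i+1}}F}{y_{i+1}-y_i}\ (1\le i\le k-1),$$ $$d_-F=F[X-(q-1)y_k;y_1,\dots,y_k]\operatorname{Exp}[-y_k^{-1}X]\Big|_{y_k^0}\ (k\ge 1),$$ $$d_+F=-T_1T_2\cdots T_k\big(y_{k+1}F[X+(q-1)y_{k+1};y_1,\dots,y_k]\big),\qquad d_+^*F=\gamma\big(F[X+(q-1)y_{k+1};y_1,\dots,y_k]\big),$$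 where $\gamma$ sends $y_i\mapsto y_{i+1}$ for $i<k+1$ and $y_{k+1}\mapsto t\,y_1$. *Correctly intertwined.* Let $\rho,\rho^*$ be actions on $V_*$ of $\mathbb A_q,\mathbb A_{q^{-1}}$. Write $T_i,d_-,d_+,y_i$ for $\rho(T_i),\rho(d_-),\rho(d_+),\rho(y_i)$, and $d_+^*=\rho^*(d_+)$, $z_i=\rho^*(y_i)$. The pair $(\rho,\rho^*)$ is *correctly intertwined* if for all $k\ge0$, on $V_k$, $$\rho^*(T_i)=T_i^{-1}\ (1\le i\le k-1),\quad\rho^*(d_-)=d_-,\quad d_+z_i=z_{i+1}d_+,\quad d_+^*y_i=y_{i+1}d_+^*\ (1\le i\le k),$$ $$z_1d_+=-tq^{k+1}y_1d_+^*:V_k\to V_{k+1}.$$ *Replication.* Actions $\rho_1$ of $\mathbb A_q$ and $\rho_2$ of $\mathbb A_{q^{-1}}$ are *obtained from $(\rho,\rho^*)$ by replication* if $$\rho_1(d_-)=\rho_2(d_-)=d_-,\quad\rho_1(T_i)=T_i,\quad\rho_2(T_i)=T_i^{-1},\quad\rho_1(d_+)=-(qt)^{-1}z_1d_+,\quad\rho_2(d_+)=-y_1d_+^*.$$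 **Theorem.** For all $m,n\in\mathbb Z_{\ge0}$ with $\gcd(m,n)=1$ there are actions $\rho_{m,n}$ of $\mathbb A_q$ and $\rho^*_{m,n}$ of $\mathbb A_{q^{-1}}$ on $V_*$ such that: 1. $\rho_{0,1}$ is given by the basic operators $T_i,d_-,d_+$; 2. $\rho^*_{1,0}$ is given by the basic operators $T_i^{-1},d_-,d_+^*$ (the latter being the image of the arrow $d_+$); 3. for each $(m,n)$: $\rho^*_{m,n}(T_i)=\rho_{m,n}(T_i)^{-1}$, $\rho^*_{m,n}(d_-)=\rho_{m,n}(d_-)$, and $\rho_{m,n}(d_+)=-q^k\rho^*_{m,n}(d_+)$ as maps $V_k\to V_{k+1}$ for all $k\ge0$; 4. for all such $(m,n)$ and $(m',n')$ with $m'n-mn'=1$, the pair $(\rho_{m,n},\rho^*_{m',n'})$ is correctly intertwined, and $(\rho_{m+m',n+n'},\rho^*_{m+m',n+n'})$ is obtained from it by replication. -/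

import Mathlib

namespace DyckPathAlgebra

noncomputable section

/-! ## The Dyck path algebra

For a field `K` and a parameter `u : K` we define the Dyck path algebra `𝔸_u` over `K`: the path
algebra of the quiver with vertex set `ℕ`, arrows `d₊ : k → k + 1`, `d₋ : k + 1 → k` and loops
`T₁, …, T_{k-1} : k → k`, modulo the relations of the algebra. Since the vertex set is infinite,
the path algebra has no unit. We first form the algebra with a unit adjoined, by generators and
relations; the path algebra itself is its non-unital subalgebra generated by the arrows and the
idempotents of the vertices. Products are written like compositions: in `a * b`, the path `b`
comes first. -/

/-- Vertices (as idempotents) and arrows of the quiver. -/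
inductive Gen : Type
  /-- the idempotent `e_k` of the vertex `k` -/
  | e (k : ℕ)
  /-- the loop `T_{i+1}` (counted from `1`) at the vertex `k + 1`; here `0 ≤ i < k` -/
  | T (k : ℕ) (i : Fin k)
  /-- the arrow `d₊` from `k` to `k + 1` -/
  | dPlus (k : ℕ)
  /-- the arrow `d₋` from `k + 1` to `k` -/
  | dMinus (k : ℕ)

/-- The vertex at which a generator begins. -/
def Gen.source : Gen → ℕ
  | .e k => k
  | .T k _ => k + 1
  | .dPlus k => k
  | .dMinus k => k + 1

/-- The vertex at which a generator ends. -/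
def Gen.target : Gen → ℕ
  | .e k => k
  | .T k _ => k + 1
  | .dPlus k => k + 1
  | .dMinus k => k

section Algebra

variable (K : Type) [Field K] (u : K)

/-- A generator as an element of the free algebra. -/
def gen (g : Gen) : FreeAlgebra K Gen := FreeAlgebra.ι K g

/-- `d₊ d₋ - d₋ d₊`, as a loop at the vertex `k + 1`, in the free algebra. -/
def freeComm (k : ℕ) : FreeAlgebra K Gen :=
  gen K (.dPlus k) * gen K (.dMinus k) - gen K (.dMinus (k + 1)) * gen K (.dPlus (k + 1))

/-- The defining relations of the Dyck path algebra with parameter `u`. The first four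
express the composition of paths, the others are the relations proper. -/
inductive Rel : FreeAlgebra K Gen → FreeAlgebra K Gen → Prop
  | idem (k : ℕ) : Rel (gen K (.e k) * gen K (.e k)) (gen K (.e k))
  | orth (k l : ℕ) (h : k ≠ l) : Rel (gen K (.e k) * gen K (.e l)) 0
  | target (g : Gen) : Rel (gen K (.e g.target) * gen K g) (gen K g)
  | source (g : Gen) : Rel (gen K g * gen K (.e g.source)) (gen K g)
  /-- `(T_i - 1)(T_i + u) = 0` -/
  | hecke (k : ℕ) (i : Fin k) :
      Rel ((gen K (.T k i) - gen K (.e (k + 1))) * (gen K (.T k i) + u • gen K (.e (k + 1)))) 0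
  /-- `T_i T_{i+1} T_i = T_{i+1} T_i T_{i+1}` -/
  | braid (k : ℕ) (i : Fin k) :
      Rel (gen K (.T (k + 1) i.castSucc) * gen K (.T (k + 1) i.succ) *
            gen K (.T (k + 1) i.castSucc))
          (gen K (.T (k + 1) i.succ) * gen K (.T (k + 1) i.castSucc) *
            gen K (.T (k + 1) i.succ))
  /-- `T_i T_j = T_j T_i` for `|i - j| > 1` -/
  | comm (k : ℕ) (i j : Fin k) (h : (i : ℕ) + 1 < j) :
      Rel (gen K (.T k i) * gen K (.T k j)) (gen K (.T k j) * gen K (.T k i))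
  /-- `d₋² T_{k-1} = d₋²` -/
  | dMinus_sq (k : ℕ) :
      Rel (gen K (.dMinus k) * gen K (.dMinus (k + 1)) * gen K (.T (k + 1) (Fin.last k)))
          (gen K (.dMinus k) * gen K (.dMinus (k + 1)))
  /-- `T_i d₋ = d₋ T_i` -/
  | T_dMinus (k : ℕ) (i : Fin k) :
      Rel (gen K (.T k i) * gen K (.dMinus (k + 1)))
          (gen K (.dMinus (k + 1)) * gen K (.T (k + 1) i.castSucc))
  /-- `T₁ d₊² = d₊²` -/
  | dPlus_sq (k : ℕ) :
      Rel (gen K (.T (k + 1) 0) * gen K (.dPlus (k + 1)) * gen K (.dPlus k))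
          (gen K (.dPlus (k + 1)) * gen K (.dPlus k))
  /-- `d₊ T_i = T_{i+1} d₊` -/
  | dPlus_T (k : ℕ) (i : Fin k) :
      Rel (gen K (.dPlus (k + 1)) * gen K (.T k i))
          (gen K (.T (k + 1) i.succ) * gen K (.dPlus (k + 1)))
  /-- `d₋ (d₊ d₋ - d₋ d₊) T_{k-1} = u (d₊ d₋ - d₋ d₊) d₋`, beginning at a vertex `≥ 2` -/
  | dMinus_comm (k : ℕ) :
      Rel (gen K (.dMinus (k + 1)) * freeComm K (k + 1) * gen K (.T (k + 1) (Fin.last k)))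
          (u • (freeComm K k * gen K (.dMinus (k + 1))))
  /-- `T₁ (d₊ d₋ - d₋ d₊) d₊ = u d₊ (d₊ d₋ - d₋ d₊)`, beginning at a vertex `≥ 1` -/
  | comm_dPlus (k : ℕ) :
      Rel (gen K (.T (k + 1) 0) * freeComm K (k + 1) * gen K (.dPlus (k + 1)))
          (u • (gen K (.dPlus (k + 1)) * freeComm K k))

/-- The Dyck path algebra with a unit adjoined. -/
abbrev UnitalAlg : Type := RingQuot (Rel K u)

/-- A generator as an element of `UnitalAlg K u`. -/
def unitalGen (g : Gen) : UnitalAlg K u := RingQuot.mkAlgHom K (Rel K u) (gen K g)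

/-- The Dyck path algebra: the (non-unital) path algebra of the quiver modulo the relations. -/
def pathAlg : NonUnitalSubalgebra K (UnitalAlg K u) :=
  NonUnitalAlgebra.adjoin K (Set.range (unitalGen K u))

/-- The Dyck path algebra as a type. -/
abbrev Alg : Type := pathAlg K u

/-- A generator as an element of the Dyck path algebra. -/
def Alg.gen (g : Gen) : Alg K u :=
  ⟨unitalGen K u g, NonUnitalAlgebra.subset_adjoin K ⟨g, rfl⟩⟩

/-- The idempotent `e_k`. -/
def Alg.e (k : ℕ) : Alg K u := Alg.gen K u (.e k)

/-- The loop `T_{i+1}` (counted from `1`) at the vertex `k + 1`. -/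
def Alg.T (k : ℕ) (i : Fin k) : Alg K u := Alg.gen K u (.T k i)

/-- `d₊` from `k` to `k + 1`. -/
def Alg.dPlus (k : ℕ) : Alg K u := Alg.gen K u (.dPlus k)

/-- `d₋` from `k + 1` to `k`. -/
def Alg.dMinus (k : ℕ) : Alg K u := Alg.gen K u (.dMinus k)

/-- The inverse of `T_{i+1}` in `e_{k+1} 𝔸 e_{k+1}` (for `u ≠ 0`). By the quadratic relation
`T² = (1 - u) T + u e`, it is `u⁻¹ (T + (u - 1) e)`. -/
def Alg.Tinv (k : ℕ) (i : Fin k) : Alg K u :=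
  u⁻¹ • (Alg.T K u k i + (u - 1) • Alg.e K u (k + 1))

/-- The loop `y₁ = (d₊ d₋ - d₋ d₊) T_k T_{k-1} ⋯ T₁ / (u^k (u - 1))` at the vertex `k + 1`. -/
def Alg.yOne (k : ℕ) : Alg K u :=
  (u ^ k * (u - 1))⁻¹ •
    (List.finRange k).reverse.foldl (fun x i => x * Alg.T K u k i)
      (Alg.dPlus K u k * Alg.dMinus K u k - Alg.dMinus K u (k + 1) * Alg.dPlus K u (k + 1))

/-- The loops `y_{i+1}` (counted from `1`, `0 ≤ i ≤ k`) at the vertex `k + 1`, given by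
`y_{i+1} = u T_i⁻¹ y_i T_i⁻¹` from `y₁`. -/
def Alg.y (k : ℕ) (i : Fin (k + 1)) : Alg K u :=
  Fin.induction (motive := fun _ => Alg K u) (Alg.yOne K u k)
    (fun j x => u • (Alg.Tinv K u k j * x * Alg.Tinv K u k j)) i

end Algebra

/-! ## The spaces `V_k` -/

/-- The field `ℚ(q)`. -/
abbrev Qq : Type := RatFunc ℚ

/-- The field `ℚ(q, t) = ℚ(q)(t)`. -/
abbrev Qqt : Type := RatFunc Qq

/-- `q` as an element of `ℚ(q)`. -/
def q₀ : Qq := RatFunc.X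

/-- `q` as an element of `ℚ(q, t)`. -/
def q : Qqt := algebraMap Qq Qqt q₀

/-- `t` as an element of `ℚ(q, t)`. -/
def t : Qqt := RatFunc.X

/-- The ring of symmetric functions over `ℚ(q, t)`, as the polynomial ring in the power sums
`p_n = p_n[X]`, `n ≥ 1`. -/
abbrev Sym : Type := MvPolynomial ℕ+ Qqt

/-- The power sum `p_n`. -/
def p (n : ℕ+) : Sym := MvPolynomial.X n

/-- `V_k = Sym[X] ⊗ ℚ(q,t)[y₁, …, y_k]`, as the polynomial ring over `ℚ(q, t)` in the power sums
`p_n` and the variables `y₁, …, y_k`. -/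
abbrev V (k : ℕ) : Type := MvPolynomial (ℕ+ ⊕ Fin k) Qqt

/-- The inclusion of `Sym[X]` into `V_k`. -/
def ofSym (k : ℕ) : Sym →ₐ[Qqt] V k := MvPolynomial.rename Sum.inl

/-- The variable `y_{i+1}` of `V_k`, `0 ≤ i < k`. -/
def yVar {k : ℕ} (i : Fin k) : V k := MvPolynomial.X (Sum.inr i)

/-- `V_* = ⨁_k V_k`. -/
abbrev VStar : Type := DirectSum ℕ V

/-- A linear map `V_k → V_l`, as an endomorphism of `V_*` that is zero on all other summands. -/
def homogeneous {k l : ℕ} (f : V k →ₗ[Qqt] V l) : Module.End Qqt VStar :=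
  DirectSum.lof Qqt ℕ V l ∘ₗ f ∘ₗ DirectSum.component Qqt ℕ V k

/-- `F ↦ F[X + (q - 1) y_{k+1}; y₁, …, y_k]`, that is `p_n ↦ p_n + (q^n - 1) y_{k+1}^n` and
`y_i ↦ y_i`. -/
def shiftPlus (k : ℕ) : V k →ₐ[Qqt] V (k + 1) :=
  MvPolynomial.aeval (Sum.elim
    (fun n : ℕ+ => ofSym (k + 1) (p n) + (q ^ (n : ℕ) - 1) • yVar (Fin.last k) ^ (n : ℕ))
    (fun i : Fin k => yVar i.castSucc))

/-- `F ↦ F[X - (q - 1) y_{k+1}; y₁, …, y_{k+1}]`, written as a polynomial in `y_{k+1}` with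
coefficients in `V_k`. -/
def shiftMinus (k : ℕ) : V (k + 1) →ₐ[Qqt] Polynomial (V k) :=
  MvPolynomial.aeval (Sum.elim
    (fun n : ℕ+ => Polynomial.C (ofSym k (p n)) - (q ^ (n : ℕ) - 1) • Polynomial.X ^ (n : ℕ))
    (Fin.snoc (α := fun _ => Polynomial (V k))
      (fun i : Fin k => Polynomial.C (yVar i)) Polynomial.X))

/-- The plethystic exponential `Exp[-w X] = exp (-∑_{n ≥ 1} p_n w^n / n)` as a power series
in `w`. -/
def expNeg : PowerSeries Sym :=
  (PowerSeries.exp Sym).subst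
    (PowerSeries.mk fun n => if h : 0 < n then -((n : Qqt)⁻¹ • p ⟨n, h⟩) else 0)

/-- `d₋ : V_{k+1} → V_k`, `d₋ F = F[X - (q - 1) y_{k+1}; y₁, …, y_{k+1}] Exp[-y_{k+1}⁻¹ X]`,
coefficient of `y_{k+1}^0`. If the first factor is `∑_j c_j y_{k+1}^j`, this coefficient is
`∑_j c_j a_j` where `a_j` is the coefficient of `w^j` in `Exp[-w X]`. -/
def dMinus (k : ℕ) : V (k + 1) →ₗ[Qqt] V k :=
  Polynomial.lsum (fun j =>
    LinearMap.mulRight Qqt (ofSym k (PowerSeries.coeff j expNeg))) ∘ₗ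
    (shiftMinus k).toLinearMap

/-- Interchanging `y_{i+1}` and `y_{i+2}` in `V_{k+1}`, `0 ≤ i < k`. -/
def swap (k : ℕ) (i : Fin k) : V (k + 1) →ₐ[Qqt] V (k + 1) :=
  MvPolynomial.rename (Sum.map id (Equiv.swap i.castSucc i.succ))

/-- The numerator `(q - 1) y_i F + (y_{i+1} - q y_i) swap(F)` of `T_i F`, where `i` counts
from `1`. -/
def heckeNum (k : ℕ) (i : Fin k) (F : V (k + 1)) : V (k + 1) :=
  (q - 1) • (yVar i.castSucc * F) +
    (yVar i.succ - q • yVar i.castSucc) * swap k i F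

/-- The denominator `y_{i+1} - y_i` of `T_i F`. -/
def heckeDen (k : ℕ) (i : Fin k) : V (k + 1) :=
  yVar i.succ - yVar i.castSucc

theorem heckeDen_ne_zero (k : ℕ) (i : Fin k) : heckeDen k i ≠ 0 := by
  unfold heckeDen
  rw [sub_ne_zero]
  intro h
  exact absurd (Sum.inr_injective (MvPolynomial.X_injective h))
    (Fin.castSucc_lt_succ (i := i)).ne'

theorem heckeDen_dvd_sub (k : ℕ) (i : Fin k) (F : V (k + 1)) :
    heckeDen k i ∣ F - swap k i F := by
  induction F using MvPolynomial.induction_on with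
  | C a => simp [swap]
  | add f g hf hg =>
    have h : f + g - swap k i (f + g) = (f - swap k i f) + (g - swap k i g) := by
      rw [map_add]; ring
    rw [h]
    exact dvd_add hf hg
  | mul_X f j hf =>
    have h : f * MvPolynomial.X j - swap k i (f * MvPolynomial.X j) =
        (f - swap k i f) * MvPolynomial.X j +
          swap k i f * (MvPolynomial.X j - swap k i (MvPolynomial.X j)) := by
      rw [map_mul]; ring
    rw [h]
    refine dvd_add (dvd_mul_of_dvd_left hf _) (dvd_mul_of_dvd_right ?_ _)
    rcases j with n | j
    · simp [swap]
    simp only [swap, MvPolynomial.rename_X, heckeDen, yVar, Sum.map_inr]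
    by_cases h1 : j = i.castSucc
    · subst h1
      rw [Equiv.swap_apply_left]
      exact ⟨-1, by ring⟩
    · by_cases h2 : j = i.succ
      · subst h2
        rw [Equiv.swap_apply_right]
      · rw [Equiv.swap_apply_of_ne_of_ne h1 h2]
        simp

theorem heckeDen_dvd_heckeNum (k : ℕ) (i : Fin k) (F : V (k + 1)) :
    heckeDen k i ∣ heckeNum k i F := by
  have h : heckeNum k i F = heckeDen k i * swap k i F +
      (q - 1) • (yVar i.castSucc * (F - swap k i F)) := by
    simp only [heckeNum, heckeDen, Algebra.smul_def, map_sub, map_one]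
    ring
  rw [h]
  refine dvd_add (dvd_mul_right _ _) ?_
  rw [Algebra.smul_def]
  exact dvd_mul_of_dvd_right (dvd_mul_of_dvd_right (heckeDen_dvd_sub k i F) _) _

/-- `T_i F = ((q - 1) y_i F + (y_{i+1} - q y_i) swap(F)) / (y_{i+1} - y_i)` on `V_{k+1}`; the
`i : Fin k` of the code is `i - 1` in this formula. -/
def heckeFun (k : ℕ) (i : Fin k) (F : V (k + 1)) : V (k + 1) :=
  (heckeDen_dvd_heckeNum k i F).choose

theorem heckeDen_mul_heckeFun (k : ℕ) (i : Fin k) (F : V (k + 1)) :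
    heckeDen k i * heckeFun k i F = heckeNum k i F :=
  (heckeDen_dvd_heckeNum k i F).choose_spec.symm

/-- `T_{i+1}` on `V_{k+1}` as a linear map. -/
def hecke (k : ℕ) (i : Fin k) : V (k + 1) →ₗ[Qqt] V (k + 1) where
  toFun := heckeFun k i
  map_add' F G := by
    apply mul_left_cancel₀ (heckeDen_ne_zero k i)
    rw [mul_add]
    simp only [heckeDen_mul_heckeFun, heckeNum, map_add, Algebra.smul_def]
    ring
  map_smul' c F := by
    apply mul_left_cancel₀ (heckeDen_ne_zero k i)
    rw [RingHom.id_apply, mul_smul_comm]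
    simp only [heckeDen_mul_heckeFun, heckeNum, map_smul]
    simp only [Algebra.smul_def]
    ring

theorem heckeDen_mul_hecke (k : ℕ) (i : Fin k) (F : V (k + 1)) :
    heckeDen k i * hecke k i F = heckeNum k i F :=
  heckeDen_mul_heckeFun k i F

/-- `d₊ : V_k → V_{k+1}`,
`d₊ F = -T₁ T₂ ⋯ T_k (y_{k+1} F[X + (q - 1) y_{k+1}; y₁, …, y_k])`. -/
def dPlus (k : ℕ) : V k →ₗ[Qqt] V (k + 1) :=
  -((List.ofFn fun i : Fin k => (hecke k i : Module.End Qqt (V (k + 1)))).prod ∘ₗ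
    LinearMap.mulLeft Qqt (yVar (Fin.last k)) ∘ₗ (shiftPlus k).toLinearMap)

/-- The substitution `y_i ↦ y_{i+1}` for `i < k + 1` and `y_{k+1} ↦ t y₁` on `V_{k+1}`, which fixes
`Sym[X]`. -/
def γ (k : ℕ) : V (k + 1) →ₐ[Qqt] V (k + 1) :=
  MvPolynomial.aeval (Sum.elim (fun n : ℕ+ => ofSym (k + 1) (p n))
    (Fin.snoc (α := fun _ => V (k + 1)) (fun i : Fin k => yVar i.succ) (t • yVar 0)))

/-- `d₊* : V_k → V_{k+1}`, `d₊* F = γ (F[X + (q - 1) y_{k+1}; y₁, …, y_k])`. -/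
def dPlusStar (k : ℕ) : V k →ₗ[Qqt] V (k + 1) :=
  (γ k).toLinearMap ∘ₗ (shiftPlus k).toLinearMap

/-! ## Actions on `V_*` -/

/-- An action of the Dyck path algebra over `ℚ(q)` with parameter `u` on `V_*` by
`ℚ(q, t)`-linear operators, such that `e_k` acts as the projection on `V_k`. -/
structure Action (u : Qq) where
  /-- the representation -/
  hom : Alg Qq u →ₙₐ[Qq] Module.End Qqt VStar
  hom_e (k : ℕ) : hom (Alg.e Qq u k) = homogeneous (LinearMap.id : V k →ₗ[Qqt] V k)

namespace Action

variable {u : Qq} (ρ : Action u)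

/-- `ρ(T_{i+1})` on `V_{k+1}`. -/
def T (k : ℕ) (i : Fin k) : Module.End Qqt VStar := ρ.hom (Alg.T Qq u k i)

/-- `ρ(d₊)` on `V_k`. -/
def dPlus (k : ℕ) : Module.End Qqt VStar := ρ.hom (Alg.dPlus Qq u k)

/-- `ρ(d₋)` on `V_{k+1}`. -/
def dMinus (k : ℕ) : Module.End Qqt VStar := ρ.hom (Alg.dMinus Qq u k)

/-- `ρ(y_{i+1})` on `V_{k+1}`. -/
def y (k : ℕ) (i : Fin (k + 1)) : Module.End Qqt VStar := ρ.hom (Alg.y Qq u k i)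

end Action

/-- `ρ` is the first basic action, of `𝔸_q`, given by `T_i`, `d₋`, `d₊`. -/
def IsFirstBasic (ρ : Action q₀) : Prop :=
  (∀ k i, ρ.T k i = homogeneous (hecke k i)) ∧
  (∀ k, ρ.dMinus k = homogeneous (dMinus k)) ∧
  (∀ k, ρ.dPlus k = homogeneous (dPlus k))

/-- `ρs` is the second basic action, of `𝔸_{q⁻¹}`, given by `T_i⁻¹`, `d₋`, `d₊*`. -/
def IsSecondBasic (ρs : Action q₀⁻¹) : Prop :=
  (∀ (k : ℕ) (i : Fin k),
    ρs.T k i * homogeneous (hecke k i) =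
      homogeneous (LinearMap.id : V (k + 1) →ₗ[Qqt] V (k + 1)) ∧
    homogeneous (hecke k i) * ρs.T k i =
      homogeneous (LinearMap.id : V (k + 1) →ₗ[Qqt] V (k + 1))) ∧
  (∀ k, ρs.dMinus k = homogeneous (dMinus k)) ∧
  (∀ k, ρs.dPlus k = homogeneous (dPlusStar k))

/-- `ρ*(T_i) = ρ(T_i)⁻¹` on each `V_k`, and `ρ*(d₋) = ρ(d₋)`. -/
def ShareTdMinus (ρ : Action q₀) (ρs : Action q₀⁻¹) : Prop :=
  (∀ (k : ℕ) (i : Fin k),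
    ρs.T k i * ρ.T k i = homogeneous (LinearMap.id : V (k + 1) →ₗ[Qqt] V (k + 1)) ∧
    ρ.T k i * ρs.T k i = homogeneous (LinearMap.id : V (k + 1) →ₗ[Qqt] V (k + 1))) ∧
  (∀ k, ρs.dMinus k = ρ.dMinus k)

/-- `ρ` and `ρ*` are correctly intertwined: `ρ*(T_i) = T_i⁻¹`, `ρ*(d₋) = d₋`,
`d₊ z_i = z_{i+1} d₊`, `d₊* y_i = y_{i+1} d₊*` and `z₁ d₊ = -t q^{k+1} y₁ d₊* : V_k → V_{k+1}`,
where `y_i = ρ(y_i)`, `z_i = ρ*(y_i)`, `d₊ = ρ(d₊)`, `d₊* = ρ*(d₊)`. -/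
def CorrectlyIntertwined (ρ : Action q₀) (ρs : Action q₀⁻¹) : Prop :=
  ShareTdMinus ρ ρs ∧
  (∀ (k : ℕ) (i : Fin (k + 1)),
    ρ.dPlus (k + 1) * ρs.y k i = ρs.y (k + 1) i.succ * ρ.dPlus (k + 1)) ∧
  (∀ (k : ℕ) (i : Fin (k + 1)),
    ρs.dPlus (k + 1) * ρ.y k i = ρ.y (k + 1) i.succ * ρs.dPlus (k + 1)) ∧
  (∀ k : ℕ, ρs.y k 0 * ρ.dPlus k = -(t * q ^ (k + 1)) • (ρ.y k 0 * ρs.dPlus k))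

/-- `(ρ₁, ρ₂)` is obtained from `(ρ, ρ*)` by replication: `ρ₁(d₋) = ρ₂(d₋) = d₋`,
`ρ₁(T_i) = T_i`, `ρ₂(T_i) = T_i⁻¹`, `ρ₁(d₊) = -(q t)⁻¹ z₁ d₊`, `ρ₂(d₊) = -y₁ d₊*`. -/
def IsReplication (ρ : Action q₀) (ρs : Action q₀⁻¹) (ρ₁ : Action q₀) (ρ₂ : Action q₀⁻¹) : Prop :=
  (∀ k i, ρ₁.T k i = ρ.T k i) ∧
  (∀ k, ρ₁.dMinus k = ρ.dMinus k) ∧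
  ShareTdMinus ρ ρ₂ ∧
  (∀ k, ρ₁.dPlus k = -(q * t)⁻¹ • (ρs.y k 0 * ρ.dPlus k)) ∧
  (∀ k, ρ₂.dPlus k = -(ρ.y k 0 * ρs.dPlus k))

end

end DyckPathAlgebra

/-! The proof has three layers.

Replication is formal. In any graded representation, $d_-$ commutes with $y_1$, $y_1$ commutes with
every $T_i$ for $i\ge2$ and with every $y_i$, and $T_1$ commutes with $y_1y_2$. For two
representations with mutually inverse $T_i$ and the same $d_-$, such that each $d_+$ shifts the
$y_i$ of the other, replacing $d_+$ by $c\,z_1d_+$ preserves all relations: $z_1$ factors out of the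
bracket $d_+d_--d_-d_+$, and the factor $z_1z_2$ that appears in products of two raising operators
commutes with $T_1$ (`Rep.Compat.rescale`). The new $y_1$ is $c\,z_1y_1$, so correct intertwining
survives when either member is replaced by its replicate. The relation $z_1d_+=-\tau
u^{k+1}y_1d_+^*$ says exactly that the two replicates are twists of one another
(`Rep.Intertwined.twist_replicate₁`), where the twist inverts $T_i$ and multiplies $d_+$ by
$-u^{-k}$. This gives the relation between $\rho_{m,n}$ and $\rho^*_{m,n}$.

The slopes are organised by the Stern–Brocot tree. Each node is an intertwined pair, and its two
children replace one member by the mediant. Vectors of determinant one descend together until they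
become the basis of some node, so every pair in the theorem is a node
(`IntertwinedPair.search_unimodular`).

It remains to check the root. Through `shiftPlus`, $V_{k+1}$ becomes $V_k[y_{k+1}]$, and $d_-$
becomes the $V_k$-linear map sending $y_{k+1}^j$ to `h j`. The two-term recursion `map_h_succ` for
these coefficients under $X\mapsto X+(q-1)y$ yields the relations of both basic actions. The basic
$y_1$ is multiplication by the variable. The basic $z_1$ is handled through $z_1T_1\cdots T_k$, a
multiple of $d_+^*d_--d_-d_+^*$, which vanishes on the image of `shiftPlus` and satisfies a simple
recursion in $y_{k+1}$. -/

namespace DyckPathAlgebra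

noncomputable section

/-! ### Words in a monoid satisfying the braid relations -/

section Words

variable {M : Type*} [Monoid M]

/-- Induction on the word, peeling off `f 0`. If the extra letter is `f 0`, it passes everything
from the third letter on and one braid move finishes. Otherwise the induction hypothesis applies and
the resulting letter is far enough from `f 0` to commute with it. -/
theorem prod_ofFn_mul_of_braid : ∀ {k : ℕ} (f : Fin (k + 1) → M)
    (_ : ∀ i : Fin k, f i.castSucc * f i.succ * f i.castSucc = f i.succ * f i.castSucc * f i.succ)
    (_ : ∀ i j : Fin (k + 1), (i : ℕ) + 1 < j → f i * f j = f j * f i) (i : Fin k),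
    (List.ofFn f).prod * f i.castSucc = f i.succ * (List.ofFn f).prod
  | 0, _, _, _, i => i.elim0
  | k + 1, f, hb, hc, i => by
    have hcomm : ∀ n (g : Fin n → M), (∀ j, f 0 * g j = g j * f 0) →
        f 0 * (List.ofFn g).prod = (List.ofFn g).prod * f 0 := fun n g hg => by
      refine (Commute.list_prod_right _ _ fun x hx => ?_ : Commute (f 0) _)
      obtain ⟨j, rfl⟩ := (List.mem_ofFn' _ _).1 hx
      exact hg j
    induction i using Fin.cases with
    | zero =>
      have h1 := hb 0
      have h2 := hcomm k (fun j => f j.succ.succ) fun j => hc _ _ (by simp)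
      simp only [Fin.castSucc_zero, Fin.succ_zero_eq_one] at h1 ⊢
      rw [List.ofFn_succ, List.prod_cons, List.ofFn_succ, List.prod_cons, mul_assoc, mul_assoc,
        ← h2, ← mul_assoc, ← mul_assoc, Fin.succ_zero_eq_one, h1]
      simp only [mul_assoc]
    | succ j =>
      have ih := prod_ofFn_mul_of_braid (fun j => f j.succ) (fun i => by
        simpa using hb i.succ) (fun i j h => hc _ _ (by simpa using h)) j
      have h2 := hc 0 j.succ.succ (by simp)
      rw [List.ofFn_succ, List.prod_cons, mul_assoc, ← Fin.succ_castSucc, ih, ← mul_assoc, h2,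
        mul_assoc]

/-- The braid relations are invariant under reversal, so this is the previous lemma in the opposite
monoid. -/
theorem prod_reverse_ofFn_mul_of_braid {k : ℕ} (f : Fin (k + 1) → M)
    (hb : ∀ i : Fin k,
      f i.castSucc * f i.succ * f i.castSucc = f i.succ * f i.castSucc * f i.succ)
    (hc : ∀ i j : Fin (k + 1), (i : ℕ) + 1 < j → f i * f j = f j * f i) (i : Fin k) :
    (List.ofFn f).reverse.prod * f i.succ = f i.castSucc * (List.ofFn f).reverse.prod := by
  have h := prod_ofFn_mul_of_braid (fun j => MulOpposite.op (f j))
    (fun i => by simp only [← MulOpposite.op_mul, ← mul_assoc]; rw [hb])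
    (fun i j hij => by simp only [← MulOpposite.op_mul]; rw [hc i j hij]) i
  have h3 : (List.ofFn fun j => MulOpposite.op (f j)).prod =
      MulOpposite.op (List.ofFn f).reverse.prod := by
    rw [MulOpposite.op_list_prod, List.map_reverse, List.reverse_reverse, List.map_ofFn]
    rfl
  rw [h3, ← MulOpposite.op_mul, ← MulOpposite.op_mul] at h
  exact (MulOpposite.op_injective h).symm

theorem prod_ofFn_succ_mul_of_braid {k : ℕ} (f : Fin (k + 1) → M)
    (hb : ∀ i : Fin k,
      f i.castSucc * f i.succ * f i.castSucc = f i.succ * f i.castSucc * f i.succ)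
    (hc : ∀ i j : Fin (k + 1), (i : ℕ) + 1 < j → f i * f j = f j * f i) :
    (List.ofFn f).prod * (List.ofFn fun i => f i.castSucc).prod =
      (List.ofFn fun i => f i.succ).prod * (List.ofFn f).prod := by
  have h : ∀ n (g g' : Fin n → M) (a : M), (∀ i, a * g i = g' i * a) →
      a * (List.ofFn g).prod = (List.ofFn g').prod * a := by
    intro n
    induction n with
    | zero => intros; simp
    | succ n ih =>
      intro g g' a hg
      rw [List.ofFn_succ, List.ofFn_succ, List.prod_cons, List.prod_cons, ← mul_assoc, hg,
        mul_assoc, ih _ _ _ fun i => hg i.succ, mul_assoc]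
  exact h _ _ _ _ (prod_ofFn_mul_of_braid f hb hc)

/-- Two basic raising operators produce the word $T_1\cdots T_{k+1}\cdot T_1\cdots T_k$. A leading
$T_1$ completes the short factor, so its effect can be tested at the right end of the word. -/
theorem mul_prod_ofFn_mul_of_braid {k : ℕ} (f : Fin (k + 1) → M)
    (hb : ∀ i : Fin k,
      f i.castSucc * f i.succ * f i.castSucc = f i.succ * f i.castSucc * f i.succ)
    (hc : ∀ i j : Fin (k + 1), (i : ℕ) + 1 < j → f i * f j = f j * f i) :
    f 0 * ((List.ofFn f).prod * (List.ofFn fun i => f i.castSucc).prod) =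
      (List.ofFn f).prod * (List.ofFn f).prod := by
  rw [prod_ofFn_succ_mul_of_braid f hb hc, ← mul_assoc]
  congr 1
  rw [List.ofFn_succ, List.prod_cons]

end Words

/-! ### Transport of ordered products along a linear map -/

section Intertwine

variable {F M N : Type*} [Field F] [AddCommGroup M] [Module F M] [AddCommGroup N] [Module F N]

theorem map_prod_ofFn (L : M →ₗ[F] N) : ∀ {n : ℕ} (f : Fin n → Module.End F M)
    (g : Fin n → Module.End F N) (_ : ∀ i x, L (f i x) = g i (L x)) (x : M),
    L ((List.ofFn f).prod x) = (List.ofFn g).prod (L x)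
  | 0, _, _, _, x => by simp
  | n + 1, f, g, h, x => by
    simp only [List.ofFn_succ, List.prod_cons, Module.End.mul_apply, h]
    rw [map_prod_ofFn L (fun i => f i.succ) (fun i => g i.succ) fun i => h i.succ]

theorem map_prod_reverse_ofFn (L : M →ₗ[F] N) : ∀ {n : ℕ} (f : Fin n → Module.End F M)
    (g : Fin n → Module.End F N) (_ : ∀ i x, L (f i x) = g i (L x)) (x : M),
    L ((List.ofFn f).reverse.prod x) = (List.ofFn g).reverse.prod (L x)
  | 0, _, _, _, x => by simp
  | n + 1, f, g, h, x => by
    simp only [List.ofFn_succ, List.reverse_cons, List.prod_append, List.prod_singleton,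
      Module.End.mul_apply, ← h]
    rw [map_prod_reverse_ofFn L (fun i => f i.succ) (fun i => g i.succ) fun i => h i.succ]

end Intertwine

/-! ### Consequences of the relations in one graded representation -/

section Rep

variable {F : Type} [Field F] {W : ℕ → Type} [∀ k, AddCommGroup (W k)] [∀ k, Module F (W k)]

/-- The commutator `d₊ d₋ - d₋ d₊` on `W (k + 1)`. -/
def bracket (dm : ∀ k, W (k + 1) →ₗ[F] W k) (dp : ∀ k, W k →ₗ[F] W (k + 1)) (k : ℕ) :
    Module.End F (W (k + 1)) :=
  dp k ∘ₗ dm k - dm (k + 1) ∘ₗ dp (k + 1)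

theorem bracket_apply (dm : ∀ k, W (k + 1) →ₗ[F] W k) (dp : ∀ k, W k →ₗ[F] W (k + 1)) (k : ℕ)
    (x : W (k + 1)) : bracket dm dp k x = dp k (dm k x) - dm (k + 1) (dp (k + 1) x) := rfl

variable (W) in
/-- A graded representation of the Dyck path algebra with parameter `u` on the spaces `W k`. -/
@[ext]
structure Rep (u : F) where
  T : ∀ k, Fin k → Module.End F (W (k + 1))
  dm : ∀ k, W (k + 1) →ₗ[F] W k
  dp : ∀ k, W k →ₗ[F] W (k + 1)
  u_ne_zero : u ≠ 0
  u_ne_one : u ≠ 1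
  hecke : ∀ k i x, T k i (T k i x) = (1 - u) • T k i x + u • x
  braid : ∀ k (i : Fin k), T (k + 1) i.castSucc * T (k + 1) i.succ * T (k + 1) i.castSucc =
    T (k + 1) i.succ * T (k + 1) i.castSucc * T (k + 1) i.succ
  comm : ∀ k (i j : Fin k), (i : ℕ) + 1 < j → T k i * T k j = T k j * T k i
  dm_dm_T : ∀ k x, dm k (dm (k + 1) (T (k + 1) (Fin.last k) x)) = dm k (dm (k + 1) x)
  dm_T : ∀ k (i : Fin k) x, dm (k + 1) (T (k + 1) i.castSucc x) = T k i (dm (k + 1) x)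
  T_dp_dp : ∀ k x, T (k + 1) 0 (dp (k + 1) (dp k x)) = dp (k + 1) (dp k x)
  dp_T : ∀ k (i : Fin k) x, dp (k + 1) (T k i x) = T (k + 1) i.succ (dp (k + 1) x)
  dm_bracket : ∀ k x, dm (k + 1) (bracket dm dp (k + 1) (T (k + 1) (Fin.last k) x)) =
    u • bracket dm dp k (dm (k + 1) x)
  bracket_dp : ∀ k x, T (k + 1) 0 (bracket dm dp (k + 1) (dp (k + 1) x)) =
    u • dp (k + 1) (bracket dm dp k x)

namespace Rep

variable {u v : F} (R : Rep W u)

theorem T_sub_one_T_add (k : ℕ) (i : Fin k) (x : W (k + 1)) :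
    R.T k i (R.T k i x) - R.T k i x + u • (R.T k i x - x) = 0 := by
  rw [R.hecke]
  module

/-- The inverse of `T`. -/
def Tinv (k : ℕ) (i : Fin k) : Module.End F (W (k + 1)) := u⁻¹ • (R.T k i + (u - 1) • 1)

theorem Tinv_apply (k : ℕ) (i : Fin k) (x : W (k + 1)) :
    R.Tinv k i x = u⁻¹ • (R.T k i x + (u - 1) • x) := rfl

@[simp]
theorem T_Tinv (k : ℕ) (i : Fin k) (x : W (k + 1)) : R.T k i (R.Tinv k i x) = x := by
  rw [Tinv_apply, map_smul, map_add, map_smul, R.hecke, inv_smul_eq_iff₀ R.u_ne_zero]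
  module

@[simp]
theorem Tinv_T (k : ℕ) (i : Fin k) (x : W (k + 1)) : R.Tinv k i (R.T k i x) = x := by
  rw [Tinv_apply, R.hecke, inv_smul_eq_iff₀ R.u_ne_zero]
  module

theorem T_mul_Tinv (k : ℕ) (i : Fin k) : R.T k i * R.Tinv k i = 1 :=
  LinearMap.ext (R.T_Tinv k i)

theorem Tinv_mul_T (k : ℕ) (i : Fin k) : R.Tinv k i * R.T k i = 1 :=
  LinearMap.ext (R.Tinv_T k i)

/-- A linear map that intertwines `T` and `T'` intertwines their inverses. -/
theorem map_Tinv {R' : Rep W u} {k l : ℕ} (L : W (k + 1) →ₗ[F] W (l + 1)) (i : Fin k) (j : Fin l)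
    (h : ∀ x, L (R.T k i x) = R'.T l j (L x)) (x : W (k + 1)) :
    L (R.Tinv k i x) = R'.Tinv l j (L x) := by
  simp only [Tinv_apply, map_smul, map_add, h]

/-- The word `T_k ⋯ T₁`. -/
def down (k : ℕ) : Module.End F (W (k + 1)) := (List.ofFn (R.T k)).reverse.prod

/-- The operator `d₊ d₋ - d₋ d₊` on `W (k + 1)`. -/
def φ (k : ℕ) : Module.End F (W (k + 1)) := bracket R.dm R.dp k

theorem φ_apply (k : ℕ) (x : W (k + 1)) :
    R.φ k x = R.dp k (R.dm k x) - R.dm (k + 1) (R.dp (k + 1) x) := rfl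

/-- The operator `y₁` on `W (k + 1)`. -/
def yOne (k : ℕ) : Module.End F (W (k + 1)) := (u ^ k * (u - 1))⁻¹ • (R.φ k * R.down k)

/-- The operator `y_{i+1}` on `W (k + 1)`. -/
def y (k : ℕ) (i : Fin (k + 1)) : Module.End F (W (k + 1)) :=
  Fin.induction (motive := fun _ => Module.End F (W (k + 1))) (R.yOne k)
    (fun j x => u • (R.Tinv k j * x * R.Tinv k j)) i

theorem y_zero (k : ℕ) : R.y k 0 = R.yOne k := rfl

theorem y_succ (k : ℕ) (i : Fin k) :
    R.y k i.succ = u • (R.Tinv k i * R.y k i.castSucc * R.Tinv k i) := by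
  simp only [y, Fin.induction_succ]

theorem y_succ_apply (k : ℕ) (i : Fin k) (x : W (k + 1)) :
    R.y k i.succ x = u • R.Tinv k i (R.y k i.castSucc (R.Tinv k i x)) := by
  rw [y_succ]; rfl

theorem y_zero_apply (k : ℕ) (x : W (k + 1)) :
    R.y k 0 x = (u ^ k * (u - 1))⁻¹ • R.φ k (R.down k x) := rfl

theorem scalar_ne_zero (R : Rep W u) (k : ℕ) : u ^ k * (u - 1) ≠ 0 :=
  mul_ne_zero (pow_ne_zero _ R.u_ne_zero) (sub_ne_zero.2 R.u_ne_one)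

theorem φ_down (k : ℕ) (x : W (k + 1)) : R.φ k (R.down k x) = (u ^ k * (u - 1)) • R.y k 0 x := by
  rw [y_zero_apply, smul_inv_smul₀ (R.scalar_ne_zero k)]

theorem down_succ (k : ℕ) : R.down (k + 1) =
    R.T (k + 1) (Fin.last k) * (List.ofFn fun i : Fin k => R.T (k + 1) i.castSucc).reverse.prod := by
  rw [down, List.ofFn_succ', List.concat_eq_append, List.reverse_append, List.prod_append]
  simp

theorem down_succ' (k : ℕ) : R.down (k + 1) =
    (List.ofFn fun i : Fin k => R.T (k + 1) i.succ).reverse.prod * R.T (k + 1) 0 := by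
  rw [down, List.ofFn_succ, List.reverse_cons, List.prod_append]
  simp

theorem φ_T (k : ℕ) (i : Fin k) (x : W (k + 2)) :
    R.φ (k + 1) (R.T (k + 1) i.castSucc x) = R.T (k + 1) i.succ (R.φ (k + 1) x) := by
  rw [φ_apply, φ_apply, R.dm_T, R.dp_T, R.dp_T, ← Fin.castSucc_succ, R.dm_T, map_sub]

/-- The leading letter $T_{k+1}$ of the descending word is the one consumed by `dm_bracket`; the
factor $u$ released there accounts for the change of normalisation. The other letters pass $d_-$
unchanged. -/
theorem dm_y_zero (k : ℕ) (x : W (k + 2)) :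
    R.dm (k + 1) (R.y (k + 1) 0 x) = R.y k 0 (R.dm (k + 1) x) := by
  have h := map_prod_reverse_ofFn (R.dm (k + 1)) (fun i : Fin k => R.T (k + 1) i.castSucc)
    (R.T k) (R.dm_T k) x
  rw [y_zero_apply, y_zero_apply, map_smul, down_succ, Module.End.mul_apply, φ, R.dm_bracket, h,
    smul_smul, pow_succ]
  congr 1
  have h1 := R.u_ne_zero
  have h2 := sub_ne_zero.2 R.u_ne_one
  field_simp

theorem dm_y (k : ℕ) (i : Fin (k + 1)) (x : W (k + 2)) :
    R.dm (k + 1) (R.y (k + 1) i.castSucc x) = R.y k i (R.dm (k + 1) x) := by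
  induction i using Fin.induction generalizing x with
  | zero => exact R.dm_y_zero k x
  | succ i ih =>
    have h := R.map_Tinv (R' := R) (R.dm (k + 1)) i.castSucc i (R.dm_T k i)
    rw [← Fin.succ_castSucc, y_succ_apply, y_succ_apply, map_smul, h, ih, h]

/-- The descending word lowers the index of $T_{i+1}$ by one and `φ` raises it again. -/
theorem y_zero_T (k : ℕ) (i : Fin k) (x : W (k + 2)) :
    R.y (k + 1) 0 (R.T (k + 1) i.succ x) = R.T (k + 1) i.succ (R.y (k + 1) 0 x) := by
  have h := DFunLike.congr_fun
    (prod_reverse_ofFn_mul_of_braid (R.T (k + 1)) (R.braid k) (R.comm (k + 1)) i) x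
  simp only [Module.End.mul_apply] at h
  rw [y_zero_apply, y_zero_apply, down, h, φ_T, map_smul]

theorem y_zero_Tinv (k : ℕ) (i : Fin k) (x : W (k + 2)) :
    R.y (k + 1) 0 (R.Tinv (k + 1) i.succ x) = R.Tinv (k + 1) i.succ (R.y (k + 1) 0 x) :=
  R.map_Tinv (R' := R) _ _ _ (R.y_zero_T k i) x

theorem dp_y_zero (k : ℕ) (x : W (k + 1)) : R.dp (k + 1) (R.y k 0 x) =
    R.T (k + 1) 0 (R.y (k + 1) 0 (R.Tinv (k + 1) 0 (R.dp (k + 1) x))) := by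
  have h := map_prod_reverse_ofFn (R.dp (k + 1)) (R.T k) (fun i : Fin k => R.T (k + 1) i.succ)
    (R.dp_T k) x
  have h1 := R.u_ne_zero
  have h2 := sub_ne_zero.2 R.u_ne_one
  have h3 := R.bracket_dp k (R.down k x)
  rw [← inv_smul_eq_iff₀ h1] at h3
  rw [y_zero_apply, y_zero_apply, map_smul, down_succ', Module.End.mul_apply, T_Tinv, ← h, φ, ← h3,
    smul_smul, pow_succ, ← φ, map_smul, ← down]
  congr 1
  field_simp

/-- Both terms of `φ` contain one $d_+$ and one $d_-$. The latter commutes with $y_1$ and $T_1$, so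
the conjugation comes from $d_+$ alone. -/
theorem φ_y_zero (k : ℕ) (x : W (k + 2)) : R.φ (k + 1) (R.y (k + 1) 0 x) =
    R.T (k + 1) 0 (R.y (k + 1) 0 (R.Tinv (k + 1) 0 (R.φ (k + 1) x))) := by
  have h := R.map_Tinv (R' := R) (R.dm (k + 2)) (Fin.castSucc 0) 0 (R.dm_T (k + 1) 0)
  have h1 := R.dm_T (k + 1) 0
  rw [Fin.castSucc_zero] at h h1
  rw [φ_apply, φ_apply, dm_y_zero, dp_y_zero, dp_y_zero, h1, dm_y_zero, h]
  simp only [map_sub]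

/-- `y₁ T₁⁻¹ y₁` commutes with `T₁`. -/
theorem y_zero_Tinv_y_zero_T (k : ℕ) (x : W (k + 2)) :
    R.y (k + 1) 0 (R.Tinv (k + 1) 0 (R.y (k + 1) 0 (R.T (k + 1) 0 x))) =
      R.T (k + 1) 0 (R.y (k + 1) 0 (R.Tinv (k + 1) 0 (R.y (k + 1) 0 x))) := by
  set P := (List.ofFn fun i : Fin k => R.T (k + 1) i.succ).reverse.prod with hP
  have hd : ∀ z, R.down (k + 1) z = P (R.T (k + 1) 0 z) := fun z => by
    rw [down_succ', Module.End.mul_apply]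
  have hPy : ∀ z, R.y (k + 1) 0 (P z) = P (R.y (k + 1) 0 z) :=
    map_prod_reverse_ofFn _ _ _ (R.y_zero_T k)
  have h := R.y_zero_apply (k + 1) (R.Tinv (k + 1) 0 (R.y (k + 1) 0 (R.T (k + 1) 0 x)))
  -- The outer $y_1$ is a multiple of $\varphi P T_1$. Its $T_1$ cancels $T_1^{-1}$, $P$ slides past
  -- the inner $y_1$, and moving $\varphi$ past that $y_1$ creates the conjugation by $T_1$.
  rw [h, hd, T_Tinv, ← hPy, φ_y_zero, ← hd, φ_down]
  simp only [map_smul]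
  rw [inv_smul_smul₀ (R.scalar_ne_zero _)]

theorem y_zero_y_one (k : ℕ) (x : W (k + 2)) :
    R.y (k + 1) 0 (R.y (k + 1) 1 x) = R.y (k + 1) 1 (R.y (k + 1) 0 x) := by
  have h := R.y_zero_Tinv_y_zero_T k (R.Tinv (k + 1) 0 x)
  rw [T_Tinv] at h
  rw [← Fin.succ_zero_eq_one, y_succ_apply, y_succ_apply, Fin.castSucc_zero, map_smul, h, Tinv_T]

/-- Only $y_2$ needs work: the later $y_i$ arise from it by conjugation with $T_j$, $j\ge2$, and
these commute with $y_1$. -/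
theorem y_zero_y (k : ℕ) (i : Fin (k + 1)) (x : W (k + 1)) :
    R.y k 0 (R.y k i x) = R.y k i (R.y k 0 x) := by
  induction i using Fin.induction generalizing x with
  | zero => rfl
  | succ i ih =>
    obtain _ | k := k
    · exact i.elim0
    induction i using Fin.cases with
    | zero => exact R.y_zero_y_one k x
    | succ i =>
      rw [y_succ_apply, y_succ_apply, map_smul, y_zero_Tinv, ih, y_zero_Tinv]

/-- `T₁` commutes with `y₁ y₂`. -/
theorem T_y_zero_y_one (k : ℕ) (x : W (k + 2)) :
    R.T (k + 1) 0 (R.y (k + 1) 0 (R.y (k + 1) 1 x)) =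
      R.y (k + 1) 0 (R.y (k + 1) 1 (R.T (k + 1) 0 x)) := by
  rw [y_zero_y_one, ← Fin.succ_zero_eq_one, y_succ_apply, y_succ_apply, Fin.castSucc_zero, map_smul,
    map_smul, T_Tinv, Tinv_T]

/-- A map that shifts the `T_i` and `y₁` shifts all `y_i`. -/
theorem map_y (k : ℕ) (L : W (k + 1) →ₗ[F] W (k + 2))
    (hT : ∀ (i : Fin k) x, L (R.T k i x) = R.T (k + 1) i.succ (L x))
    (h0 : ∀ x, L (R.y k 0 x) = R.y (k + 1) 1 (L x)) (i : Fin (k + 1)) (x : W (k + 1)) :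
    L (R.y k i x) = R.y (k + 1) i.succ (L x) := by
  induction i using Fin.induction generalizing x with
  | zero => exact h0 x
  | succ i ih =>
    have h := R.map_Tinv (R' := R) L i i.succ (hT i)
    rw [y_succ_apply, y_succ_apply, map_smul, h, ih, h, Fin.castSucc_succ]

end Rep

end Rep

/-! ### Twisting, rescaling and replication -/

section Replication

variable {F : Type} [Field F] {W : ℕ → Type} [∀ k, AddCommGroup (W k)] [∀ k, Module F (W k)]

namespace Rep

variable {u v : F} (R : Rep W u)

/-- `T` as a unit. -/
def TUnit (k : ℕ) (i : Fin k) : (Module.End F (W (k + 1)))ˣ :=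
  ⟨R.T k i, R.Tinv k i, R.T_mul_Tinv k i, R.Tinv_mul_T k i⟩

/-- The representation with the inverse parameter in which `T` acts by `T⁻¹`, `d₋` by `d₋`, and
`d₊` by `-u^{-k} d₊` on `W k`. -/
def twist (h : u * v = 1) : Rep W v where
  T := R.Tinv
  dm := R.dm
  dp k := -v ^ k • R.dp k
  u_ne_zero := right_ne_zero_of_mul_eq_one h
  u_ne_one := by rintro rfl; exact R.u_ne_one (by simpa using h)
  hecke k i x := by
    have hu := R.u_ne_zero
    obtain rfl := eq_inv_of_mul_eq_one_right h
    simp only [Tinv_apply, map_smul, map_add, R.hecke]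
    match_scalars <;> field_simp <;> ring
  braid k i := by
    have h := congrArg (fun a => ((a⁻¹ : (Module.End F (W (k + 2)))ˣ) : Module.End F (W (k + 2))))
      (Units.ext (R.braid k i) : R.TUnit (k + 1) i.castSucc * R.TUnit (k + 1) i.succ *
        R.TUnit (k + 1) i.castSucc = R.TUnit (k + 1) i.succ * R.TUnit (k + 1) i.castSucc *
        R.TUnit (k + 1) i.succ)
    simp only [mul_inv_rev, Units.val_mul, ← mul_assoc] at h
    exact h
  comm k i j hij := by
    have h := congrArg (fun a => ((a⁻¹ : (Module.End F (W (k + 1)))ˣ) : Module.End F (W (k + 1))))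
      (Units.ext (R.comm k i j hij) : R.TUnit k i * R.TUnit k j = R.TUnit k j * R.TUnit k i)
    simp only [mul_inv_rev, Units.val_mul] at h
    exact h.symm
  dm_dm_T k x := by rw [← R.dm_dm_T, T_Tinv]
  dm_T k i x := by simp only [Tinv_apply, map_smul, map_add, R.dm_T]
  T_dp_dp k x := by
    simp only [LinearMap.smul_apply, map_smul]
    conv_lhs => rw [← R.T_dp_dp, Tinv_T]
  dp_T k i x := by
    simp only [LinearMap.smul_apply, map_smul]
    simp only [Tinv_apply, map_smul, map_add, R.dp_T]
  dm_bracket k x := by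
    have h1 := R.dm_bracket k (R.Tinv (k + 1) (Fin.last k) x)
    -- $d_+$ carries the last $T$ to the last $T$ one level up, so $d_-^2d_+$ absorbs it. Thus
    -- composing the old relation with $T^{-1}$ and multiplying by $v$ regroups it into the twisted
    -- one.
    have h2 : ∀ w, R.dm (k + 1) (R.dm (k + 2) (R.dp (k + 2) (R.T (k + 1) (Fin.last k) w))) =
      R.dm (k + 1) (R.dm (k + 2) (R.dp (k + 2) w)) := fun w => by
      rw [R.dp_T, Fin.succ_last, R.dm_dm_T]
    have h3 := h2 (R.Tinv (k + 1) (Fin.last k) x)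
    have h4 := R.dm_dm_T k (R.Tinv (k + 1) (Fin.last k) x)
    rw [T_Tinv] at h3 h4
    simp only [bracket_apply, LinearMap.smul_apply, map_smul, map_sub, T_Tinv] at h1 ⊢
    rw [h4] at *
    rw [h3] at h1
    have h5 := congrArg (fun z => v • z) h1
    simp only [smul_sub, smul_smul, mul_comm v u, h, one_smul] at h5
    linear_combination (norm := module) (-v ^ (k + 1)) • h5
  bracket_dp k x := by
    have h1 := R.bracket_dp k x
    -- Dually, $T_1$ fixes both $d_-d_+^2$ and $d_+^2d_-$, so applying $vT_1^{-1}$ to the old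
    -- relation suffices.
    have h2 := R.dm_T (k + 1) 0 (R.dp (k + 2) (R.dp (k + 1) x))
    rw [Fin.castSucc_zero, R.T_dp_dp] at h2
    have h3 := congrArg (fun z => v • R.Tinv (k + 1) 0 z) h1
    have h4 : R.Tinv (k + 1) 0 (R.dm (k + 2) (R.dp (k + 2) (R.dp (k + 1) x))) =
      R.dm (k + 2) (R.dp (k + 2) (R.dp (k + 1) x)) := by conv_lhs => rw [h2, Tinv_T]
    have h5 : R.Tinv (k + 1) 0 (R.dp (k + 1) (R.dp k (R.dm k x))) =
      R.dp (k + 1) (R.dp k (R.dm k x)) := by conv_lhs => rw [← R.T_dp_dp, Tinv_T]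
    simp only [bracket_apply, map_sub, map_smul, Tinv_T, smul_sub, smul_smul, mul_comm v u, h,
      one_smul, h5] at h3
    simp only [bracket_apply, LinearMap.smul_apply, map_smul, map_sub, h4]
    linear_combination (norm := module) (v ^ (2 * k + 2)) • h3

theorem twist_dp (h : u * v = 1) (k : ℕ) : (R.twist h).dp k = -v ^ k • R.dp k := rfl

theorem Tinv_eq_of_T_eq_Tinv {R : Rep W u} {S : Rep W v} {k : ℕ} {i : Fin k}
    (h : S.T k i = R.Tinv k i) : S.Tinv k i = R.T k i := by
  ext x
  rw [← S.Tinv_T k i (R.T k i x), h, R.Tinv_T]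

theorem twist_twist (h : u * v = 1) (h' : v * u = 1) : (R.twist h).twist h' = R := by
  refine Rep.ext ?_ rfl ?_
  · funext k i
    exact Tinv_eq_of_T_eq_Tinv rfl
  · funext k
    rw [twist_dp, twist_dp, smul_smul, neg_mul_neg, ← mul_pow, h, one_pow, one_smul]

/-- Two representations whose `T_i` are mutually inverse, with the same `d₋`, such that `d₊` of each
shifts the `y_i` of the other. -/
structure Compat (R : Rep W u) (S : Rep W v) : Prop where
  T_eq : ∀ k i, S.T k i = R.Tinv k i
  dm_eq : ∀ k, S.dm k = R.dm k
  dp_y : ∀ k i x, R.dp (k + 1) (S.y k i x) = S.y (k + 1) i.succ (R.dp (k + 1) x)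
  dp_y' : ∀ k i x, S.dp (k + 1) (R.y k i x) = R.y (k + 1) i.succ (S.dp (k + 1) x)

namespace Compat

variable {R : Rep W u} {S : Rep W v}

theorem Tinv_eq (h : Compat R S) (k : ℕ) (i : Fin k) : S.Tinv k i = R.T k i :=
  Tinv_eq_of_T_eq_Tinv (h.T_eq k i)

theorem symm (h : Compat R S) : Compat S R where
  T_eq k i := (h.Tinv_eq k i).symm
  dm_eq k := (h.dm_eq k).symm
  dp_y := h.dp_y'
  dp_y' := h.dp_y

theorem dm_y (h : Compat R S) (k : ℕ) (i : Fin (k + 1)) (x : W (k + 2)) :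
    R.dm (k + 1) (S.y (k + 1) i.castSucc x) = S.y k i (R.dm (k + 1) x) := by
  rw [← h.dm_eq, S.dm_y]

/-- $d_-$ is shared by both representations, hence commutes with $z_1$, and $cz_1$ factors out of
both terms. -/
theorem bracket_rescale (h : Compat R S) (c : F) (k : ℕ) (x : W (k + 1)) :
    bracket R.dm (fun k => c • S.y k 0 ∘ₗ R.dp k) k x = c • S.y k 0 (R.φ k x) := by
  have h1 := h.dm_y k 0 (R.dp (k + 1) x)
  rw [Fin.castSucc_zero] at h1
  simp only [bracket_apply, LinearMap.smul_apply, LinearMap.comp_apply, map_smul, h1, φ_apply,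
    map_sub, smul_sub]

theorem φ_y_zero (h : Compat R S) (k : ℕ) (x : W (k + 2)) :
    R.φ (k + 1) (S.y (k + 1) 0 x) = S.y (k + 1) 1 (R.φ (k + 1) x) := by
  have h1 := h.dm_y k 0
  have h2 := h.dm_y (k + 1) 1
  rw [Fin.castSucc_zero] at h1
  rw [Fin.castSucc_one] at h2
  simp only [φ_apply, h1, h.dp_y, map_sub, Fin.succ_zero_eq_one, h2]

/-- The representation in which `d₊` acts by `c z₁ d₊`. -/
def rescale (h : Compat R S) (c : F) : Rep W u where
  T := R.T
  dm := R.dm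
  dp k := c • S.y k 0 ∘ₗ R.dp k
  u_ne_zero := R.u_ne_zero
  u_ne_one := R.u_ne_one
  hecke := R.hecke
  braid := R.braid
  comm := R.comm
  dm_dm_T := R.dm_dm_T
  dm_T := R.dm_T
  T_dp_dp k x := by
    simp only [LinearMap.smul_apply, LinearMap.comp_apply, map_smul, h.dp_y, Fin.succ_zero_eq_one]
    conv_lhs => rw [← R.T_dp_dp, ← h.Tinv_eq]
    -- The square of $z_1d_+$ is $z_1z_2d_+^2$, and $z_1z_2$ commutes with the Hecke generator.
    have h1 : ∀ x, S.Tinv (k + 1) 0 (S.y (k + 1) 0 (S.y (k + 1) 1 x)) =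
        S.y (k + 1) 0 (S.y (k + 1) 1 (S.Tinv (k + 1) 0 x)) := fun x => by
      rw [← S.T_Tinv (k + 1) 0 x, ← T_y_zero_y_one, Tinv_T, Tinv_T]
    rw [h1, Tinv_eq_of_T_eq_Tinv (h.T_eq _ _), R.T_dp_dp, R.T_dp_dp]
  dp_T k i x := by
    simp only [LinearMap.smul_apply, LinearMap.comp_apply, map_smul, R.dp_T]
    rw [← h.Tinv_eq, S.y_zero_Tinv]
  dm_bracket k x := by
    have h1 := h.dm_y k 0
    rw [Fin.castSucc_zero] at h1
    rw [h.bracket_rescale, h.bracket_rescale, map_smul, h1, φ, R.dm_bracket, map_smul, smul_comm, φ]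
  bracket_dp k x := by
    rw [h.bracket_rescale, h.bracket_rescale]
    simp only [LinearMap.smul_apply, LinearMap.comp_apply, map_smul, h.φ_y_zero, h.dp_y]
    have h1 : ∀ x, R.T (k + 1) 0 (S.y (k + 1) 0 (S.y (k + 1) 1 x)) =
        S.y (k + 1) 0 (S.y (k + 1) 1 (R.T (k + 1) 0 x)) := fun x => by
      rw [← h.Tinv_eq, ← S.T_Tinv (k + 1) 0 x, ← T_y_zero_y_one, Tinv_T, Tinv_T]
    rw [h1, φ, R.bracket_dp, map_smul, map_smul, smul_comm u, smul_comm u, φ, Fin.succ_zero_eq_one]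

theorem rescale_dp (h : Compat R S) (c : F) (k : ℕ) :
    (h.rescale c).dp k = c • S.y k 0 ∘ₗ R.dp k := rfl

theorem rescale_y_zero (h : Compat R S) (c : F) (k : ℕ) (x : W (k + 1)) :
    (h.rescale c).y k 0 x = c • S.y k 0 (R.y k 0 x) := by
  have h1 : (h.rescale c).y k 0 x =
      (u ^ k * (u - 1))⁻¹ • bracket R.dm (fun k => c • S.y k 0 ∘ₗ R.dp k) k (R.down k x) := rfl
  rw [h1, h.bracket_rescale, R.y_zero_apply, map_smul, smul_comm]

theorem rescale_y_one (h : Compat R S) (c : F) (k : ℕ) (x : W (k + 2)) :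
    (h.rescale c).y (k + 1) 1 x = u • R.Tinv (k + 1) 0 (c • S.y (k + 1) 0 (R.y (k + 1) 0
      (R.Tinv (k + 1) 0 x))) := by
  rw [← rescale_y_zero h, ← Fin.succ_zero_eq_one, y_succ_apply]
  rfl

/-- One family of relations only adds a factor $z_1$, which commutes with all $z_i$. For the other,
`map_y` reduces everything to the new $y_1=c\,z_1y_1$. -/
theorem rescale_compat (h : Compat R S) (c : F) : Compat (h.rescale c) S where
  T_eq := h.T_eq
  dm_eq := h.dm_eq
  dp_y k i x := by
    simp only [rescale_dp, LinearMap.smul_apply, LinearMap.comp_apply, map_smul, h.dp_y, y_zero_y]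
  dp_y' k i x := by
    refine (h.rescale c).map_y k (S.dp (k + 1)) (fun i x => ?_) (fun x => ?_) i x
    · change S.dp (k + 1) (R.T k i x) = R.T (k + 1) i.succ (S.dp (k + 1) x)
      rw [← h.Tinv_eq, ← h.Tinv_eq]
      simp only [Tinv_apply, map_smul, map_add, S.dp_T]
    -- Moving $d_+^*$ past $z_1$ leaves $T_1^{-1}z_1T_1$. Its $T_1$ cancels the first $T_1^{-1}$ in
    -- $y_2=uT_1^{-1}y_1T_1^{-1}$, which leaves the new $y_2$.
    · rw [rescale_y_zero, map_smul, dp_y_zero, rescale_y_one, h.T_eq, h.Tinv_eq, h.dp_y',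
        Fin.succ_zero_eq_one, ← Fin.succ_zero_eq_one, R.y_succ_apply, Fin.castSucc_zero, map_smul,
        T_Tinv, map_smul, map_smul, map_smul, smul_comm]

end Compat

/-- Correctly intertwined representations with parameters `u` and `v = u⁻¹`. -/
structure Intertwined (τ : F) (R : Rep W u) (S : Rep W v) : Prop extends Compat R S where
  z_dp : ∀ k x, S.y k 0 (R.dp k x) = -(τ * u ^ (k + 1)) • R.y k 0 (S.dp k x)

namespace Intertwined

variable {τ : F} {R : Rep W u} {S : Rep W v}

/-- The first half of the replication of a correctly intertwined pair. -/
def replicate₁ (h : Intertwined τ R S) : Rep W u := h.toCompat.rescale (-(u * τ)⁻¹)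

/-- The second half of the replication of a correctly intertwined pair. -/
def replicate₂ (h : Intertwined τ R S) : Rep W v := h.toCompat.symm.rescale (-1)

/-- Apply $cz_1$ to the old relation: $cz_1d_+$ and $cz_1y_1$ are the new $d_+$ and $y_1$. -/
theorem intertwined_replicate₁ (h : Intertwined τ R S) : Intertwined τ h.replicate₁ S where
  toCompat := h.toCompat.rescale_compat _
  z_dp k x := by
    rw [replicate₁, Compat.rescale_dp, LinearMap.smul_apply, LinearMap.comp_apply, h.z_dp, map_smul,
      map_smul, Compat.rescale_y_zero, smul_comm]

theorem intertwined_replicate₂ (h : Intertwined τ R S) : Intertwined τ R h.replicate₂ where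
  toCompat := (h.toCompat.symm.rescale_compat _).symm
  z_dp k x := by
    rw [replicate₂, Compat.rescale_dp, LinearMap.smul_apply, LinearMap.comp_apply,
      Compat.rescale_y_zero, h.z_dp, map_smul, map_smul, smul_comm]

/-- The scalars $-v^k$ and $-(u\tau)^{-1}$, together with $-\tau u^{k+1}$ from `z_dp`, multiply to
$-1$. -/
theorem twist_replicate₁ (hτ : τ ≠ 0) (huv : u * v = 1) (h : Intertwined τ R S) :
    h.replicate₁.twist huv = h.replicate₂ := by
  refine Rep.ext ?_ ?_ ?_
  · funext k i; exact (h.T_eq k i).symm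
  · funext k; exact (h.dm_eq k).symm
  · funext k
    ext x
    rw [twist_dp, replicate₁, replicate₂, Compat.rescale_dp, Compat.rescale_dp]
    simp only [LinearMap.smul_apply, LinearMap.comp_apply, h.z_dp, smul_smul]
    congr 1
    have hu := R.u_ne_zero
    obtain rfl := eq_inv_of_mul_eq_one_right huv
    rw [inv_pow, pow_succ]
    field_simp

end Intertwined

end Rep

end Replication

/-! ### Homogeneous operators on the direct sum -/

section Homogeneous

theorem homogeneous_lof {k l : ℕ} (f : V k →ₗ[Qqt] V l) (x : V k) :
    homogeneous f (DirectSum.lof Qqt ℕ V k x) = DirectSum.lof Qqt ℕ V l (f x) := by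
  simp [homogeneous, DirectSum.component.lof_self]

theorem homogeneous_lof_of_ne {k l j : ℕ} (h : j ≠ k) (f : V k →ₗ[Qqt] V l) (x : V j) :
    homogeneous f (DirectSum.lof Qqt ℕ V j x) = 0 := by
  simp only [homogeneous, LinearMap.comp_apply, DirectSum.component.of, dif_neg h, map_zero]

theorem homogeneous_mul {k l j : ℕ} (f : V l →ₗ[Qqt] V j) (g : V k →ₗ[Qqt] V l) :
    homogeneous f * homogeneous g = homogeneous (f ∘ₗ g) := by
  refine DirectSum.linearMap_ext Qqt fun i => LinearMap.ext fun x => ?_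
  simp only [LinearMap.comp_apply, Module.End.mul_apply]
  by_cases h : i = k
  · subst h
    simp only [homogeneous_lof, LinearMap.comp_apply]
  · simp only [homogeneous_lof_of_ne h, map_zero]

theorem homogeneous_mul_of_ne {k l l' j : ℕ} (h : l' ≠ l) (f : V l →ₗ[Qqt] V j)
    (g : V k →ₗ[Qqt] V l') : homogeneous f * homogeneous g = 0 := by
  refine DirectSum.linearMap_ext Qqt fun i => LinearMap.ext fun x => ?_
  simp only [LinearMap.comp_apply, Module.End.mul_apply, LinearMap.zero_apply]
  by_cases hi : i = k
  · subst hi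
    rw [homogeneous_lof, homogeneous_lof_of_ne h]
  · simp only [homogeneous_lof_of_ne hi, map_zero]

theorem homogeneous_add {k l : ℕ} (f g : V k →ₗ[Qqt] V l) :
    homogeneous (f + g) = homogeneous f + homogeneous g := by
  simp only [homogeneous, LinearMap.add_comp, LinearMap.comp_add]

theorem homogeneous_sub {k l : ℕ} (f g : V k →ₗ[Qqt] V l) :
    homogeneous (f - g) = homogeneous f - homogeneous g := by
  simp only [homogeneous, LinearMap.sub_comp, LinearMap.comp_sub]

theorem homogeneous_zero {k l : ℕ} : homogeneous (0 : V k →ₗ[Qqt] V l) = 0 := by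
  simp only [homogeneous, LinearMap.zero_comp, LinearMap.comp_zero]

theorem homogeneous_smul {k l : ℕ} (c : Qqt) (f : V k →ₗ[Qqt] V l) :
    homogeneous (c • f) = c • homogeneous f := by
  simp only [homogeneous, LinearMap.smul_comp, LinearMap.comp_smul]

theorem homogeneous_smul' {k l : ℕ} (c : Qq) (f : V k →ₗ[Qqt] V l) :
    c • homogeneous f = homogeneous (algebraMap Qq Qqt c • f) := by
  rw [homogeneous_smul, algebraMap_smul]

end Homogeneous

/-! ### From graded representations to actions of the path algebra -/

namespace Rep

variable {u : Qq} {w : Qqt} (R : Rep V w) (hu : algebraMap Qq Qqt u = w)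

/-- The operator on `V_*` by which a generator acts. -/
def genMap : Gen → Module.End Qqt VStar
  | .e k => homogeneous (LinearMap.id : V k →ₗ[Qqt] V k)
  | .T k i => homogeneous (R.T k i)
  | .dPlus k => homogeneous (R.dp k)
  | .dMinus k => homogeneous (R.dm k)

theorem lift_gen (g : Gen) : FreeAlgebra.lift Qq R.genMap (gen Qq g) = R.genMap g :=
  FreeAlgebra.lift_ι_apply _ _

theorem lift_freeComm (k : ℕ) :
    FreeAlgebra.lift Qq R.genMap (freeComm Qq k) = homogeneous (bracket R.dm R.dp k) := by
  simp only [freeComm, map_sub, map_mul, lift_gen, genMap, homogeneous_mul, bracket,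
    homogeneous_sub]

theorem lift_rel (R : Rep V w) (hu : algebraMap Qq Qqt u = w) ⦃a b : FreeAlgebra Qq Gen⦄
    (h : Rel Qq u a b) :
    FreeAlgebra.lift Qq R.genMap a = FreeAlgebra.lift Qq R.genMap b := by
  induction h with
  | idem k => simp only [map_mul, lift_gen, genMap, homogeneous_mul, LinearMap.id_comp]
  | orth k l h =>
    simp only [map_mul, lift_gen, genMap, map_zero]
    exact homogeneous_mul_of_ne h.symm _ _
  | target g =>
    cases g <;>
      simp only [map_mul, lift_gen, genMap, Gen.target, homogeneous_mul, LinearMap.id_comp]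
  | source g =>
    cases g <;>
      simp only [map_mul, lift_gen, genMap, Gen.source, homogeneous_mul, LinearMap.comp_id]
  | hecke k i =>
    simp only [map_mul, map_sub, map_add, map_smul, lift_gen, genMap, homogeneous_smul', hu,
      ← homogeneous_sub, ← homogeneous_add, homogeneous_mul, map_zero]
    rw [← homogeneous_zero (k := k + 1) (l := k + 1)]
    refine congrArg homogeneous (LinearMap.ext fun x => ?_)
    simp only [LinearMap.comp_apply, LinearMap.sub_apply, LinearMap.add_apply,
      LinearMap.smul_apply, LinearMap.id_apply, map_add, map_smul, LinearMap.zero_apply]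
    exact R.T_sub_one_T_add k i x
  | braid k i =>
    simp only [map_mul, lift_gen, genMap, homogeneous_mul]
    exact congrArg homogeneous (R.braid k i)
  | comm k i j h =>
    simp only [map_mul, lift_gen, genMap, homogeneous_mul]
    exact congrArg homogeneous (R.comm k i j h)
  | dMinus_sq k =>
    simp only [map_mul, lift_gen, genMap, homogeneous_mul]
    exact congrArg homogeneous (LinearMap.ext (R.dm_dm_T k))
  | T_dMinus k i =>
    simp only [map_mul, lift_gen, genMap, homogeneous_mul]
    exact congrArg homogeneous (LinearMap.ext fun x => (R.dm_T k i x).symm)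
  | dPlus_sq k =>
    simp only [map_mul, lift_gen, genMap, homogeneous_mul]
    exact congrArg homogeneous (LinearMap.ext (R.T_dp_dp k))
  | dPlus_T k i =>
    simp only [map_mul, lift_gen, genMap, homogeneous_mul]
    exact congrArg homogeneous (LinearMap.ext (R.dp_T k i))
  | dMinus_comm k =>
    simp only [map_mul, map_smul, lift_gen, lift_freeComm, genMap, homogeneous_mul,
      homogeneous_smul', hu]
    exact congrArg homogeneous (LinearMap.ext (R.dm_bracket k))
  | comm_dPlus k =>
    simp only [map_mul, map_smul, lift_gen, lift_freeComm, genMap, homogeneous_mul,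
      homogeneous_smul', hu]
    exact congrArg homogeneous (LinearMap.ext (R.bracket_dp k))

/-- The action of the algebra with a unit adjoined. -/
def unitalHom : UnitalAlg Qq u →ₐ[Qq] Module.End Qqt VStar :=
  RingQuot.liftAlgHom Qq ⟨FreeAlgebra.lift Qq R.genMap, R.lift_rel hu⟩

theorem unitalHom_unitalGen (g : Gen) : (R.unitalHom hu) (unitalGen Qq u g) = R.genMap g := by
  rw [unitalHom, unitalGen, RingQuot.liftAlgHom_mkAlgHom_apply, lift_gen]

/-- The action on `V_*` defined by a graded representation. -/
def toAction : Action u where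
  hom := ((R.unitalHom hu) : UnitalAlg Qq u →ₙₐ[Qq] Module.End Qqt VStar).comp
    (NonUnitalSubalgebraClass.subtype (pathAlg Qq u))
  hom_e k := R.unitalHom_unitalGen hu (.e k)

theorem toAction_hom_gen (g : Gen) : (R.toAction hu).hom (Alg.gen Qq u g) = R.genMap g :=
  R.unitalHom_unitalGen hu g

theorem toAction_T (k : ℕ) (i : Fin k) : (R.toAction hu).T k i = homogeneous (R.T k i) :=
  R.toAction_hom_gen hu _

theorem toAction_dPlus (k : ℕ) : (R.toAction hu).dPlus k = homogeneous (R.dp k) :=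
  R.toAction_hom_gen hu _

theorem toAction_dMinus (k : ℕ) : (R.toAction hu).dMinus k = homogeneous (R.dm k) :=
  R.toAction_hom_gen hu _

theorem toAction_hom_foldl {k : ℕ} (l : List (Fin k)) (x : Alg Qq u)
    (f : Module.End Qqt (V (k + 1))) (h : (R.toAction hu).hom x = homogeneous f) :
    (R.toAction hu).hom (l.foldl (fun x i => x * Alg.T Qq u k i) x) =
      homogeneous (f * (l.map (R.T k)).prod) := by
  induction l generalizing x f with
  | nil => simpa using h
  | cons i l ih =>
    rw [List.foldl_cons, ih _ (f * R.T k i), List.map_cons, List.prod_cons, mul_assoc]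
    rw [map_mul, h, Alg.T, R.toAction_hom_gen hu, genMap, homogeneous_mul]
    rfl

theorem toAction_hom_Tinv (k : ℕ) (i : Fin k) :
    (R.toAction hu).hom (Alg.Tinv Qq u k i) = homogeneous (R.Tinv k i) := by
  have h := R.toAction_hom_gen hu (.T k i)
  have h' := R.toAction_hom_gen hu (.e (k + 1))
  rw [Alg.Tinv, map_smul, map_add, map_smul, Alg.T, Alg.e, h, h', genMap, genMap,
    homogeneous_smul', ← homogeneous_add, homogeneous_smul', Tinv, map_inv₀, map_sub, map_one, hu]
  rfl

theorem toAction_y (k : ℕ) (i : Fin (k + 1)) : (R.toAction hu).y k i = homogeneous (R.y k i) := by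
  rw [Action.y]
  induction i using Fin.induction with
  | zero =>
    have h : (R.toAction hu).hom (Alg.dPlus Qq u k * Alg.dMinus Qq u k -
        Alg.dMinus Qq u (k + 1) * Alg.dPlus Qq u (k + 1)) = homogeneous (R.φ k) := by
      rw [φ, bracket, homogeneous_sub, ← homogeneous_mul, ← homogeneous_mul]
      refine (eq_sub_iff_add_eq (G := Module.End Qqt VStar)).2 ?_
      have h1 := R.toAction_hom_gen hu (.dPlus k)
      have h2 := R.toAction_hom_gen hu (.dMinus k)
      have h3 := R.toAction_hom_gen hu (.dPlus (k + 1))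
      have h4 := R.toAction_hom_gen hu (.dMinus (k + 1))
      simp only [genMap] at h1 h2 h3 h4
      rw [← h1, ← h2, ← h3, ← h4, ← map_mul, ← map_mul, ← map_add]
      exact congrArg _ (Subtype.ext (sub_add_cancel (G := UnitalAlg Qq u) _ _))
    have h0 : Alg.y Qq u k 0 = Alg.yOne Qq u k := rfl
    rw [h0, Alg.yOne, map_smul, R.toAction_hom_foldl hu _ _ _ h, homogeneous_smul', y_zero, yOne, down,
      map_inv₀, map_mul, map_pow, map_sub, map_one, hu,
      List.map_reverse, ← List.ofFn_eq_map]
  | succ i ih =>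
    have h0 : Alg.y Qq u k i.succ =
        u • (Alg.Tinv Qq u k i * Alg.y Qq u k i.castSucc * Alg.Tinv Qq u k i) := by
      simp only [Alg.y, Fin.induction_succ]
    rw [h0, map_smul, map_mul, map_mul, ih, toAction_hom_Tinv, homogeneous_mul, homogeneous_mul,
      homogeneous_smul', y_succ, hu]
    rfl

end Rep

theorem algebraMap_q₀ : algebraMap Qq Qqt q₀ = q := rfl

theorem algebraMap_q₀_inv : algebraMap Qq Qqt q₀⁻¹ = q⁻¹ := map_inv₀ _ _

theorem q_ne_zero : q ≠ 0 := by
  rw [q, q₀, Ne, map_eq_zero_iff _ (algebraMap Qq Qqt).injective]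
  exact RatFunc.X_ne_zero

theorem t_ne_zero : t ≠ 0 := RatFunc.X_ne_zero

theorem q_ne_one : q ≠ 1 := by
  rw [q, q₀, Ne, ← map_one (algebraMap Qq Qqt), (algebraMap Qq Qqt).injective.eq_iff]
  intro h
  have h1 : algebraMap (Polynomial ℚ) (RatFunc ℚ) Polynomial.X =
      algebraMap (Polynomial ℚ) (RatFunc ℚ) 1 := by rw [RatFunc.algebraMap_X, h, map_one]
  exact Polynomial.X_ne_C 1 (RatFunc.algebraMap_injective ℚ h1)

theorem q_mul_q_inv : q * q⁻¹ = 1 := mul_inv_cancel₀ q_ne_zero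

theorem q_inv_mul_q : q⁻¹ * q = 1 := inv_mul_cancel₀ q_ne_zero

namespace Rep

theorem shareTdMinus {R : Rep V q} {S : Rep V q⁻¹} (hT : ∀ k i, S.T k i = R.Tinv k i)
    (hdm : ∀ k, S.dm k = R.dm k) :
    ShareTdMinus (R.toAction algebraMap_q₀) (S.toAction algebraMap_q₀_inv) := by
  refine ⟨fun k i => ⟨?_, ?_⟩, fun k => ?_⟩
  · rw [toAction_T, toAction_T, homogeneous_mul, hT]
    exact congrArg homogeneous (R.Tinv_mul_T k i)
  · rw [toAction_T, toAction_T, homogeneous_mul, hT]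
    exact congrArg homogeneous (R.T_mul_Tinv k i)
  · rw [toAction_dMinus, toAction_dMinus, hdm]

theorem Intertwined.correctlyIntertwined {R : Rep V q} {S : Rep V q⁻¹} (h : Intertwined t R S) :
    CorrectlyIntertwined (R.toAction algebraMap_q₀) (S.toAction algebraMap_q₀_inv) := by
  refine ⟨shareTdMinus h.T_eq h.dm_eq, fun k i => ?_, fun k i => ?_, fun k => ?_⟩
  · rw [toAction_dPlus, toAction_y, toAction_y, homogeneous_mul, homogeneous_mul]
    exact congrArg homogeneous (LinearMap.ext (h.dp_y k i))
  · rw [toAction_dPlus, toAction_y, toAction_y, homogeneous_mul, homogeneous_mul]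
    exact congrArg homogeneous (LinearMap.ext (h.dp_y' k i))
  · rw [toAction_dPlus, toAction_y, toAction_dPlus, toAction_y, homogeneous_mul, homogeneous_mul,
      ← homogeneous_smul]
    exact congrArg homogeneous (LinearMap.ext (h.z_dp k))

theorem Intertwined.isReplication {R : Rep V q} {S : Rep V q⁻¹} (h : Intertwined t R S) :
    IsReplication (R.toAction algebraMap_q₀) (S.toAction algebraMap_q₀_inv)
      (h.replicate₁.toAction algebraMap_q₀) (h.replicate₂.toAction algebraMap_q₀_inv) := by
  refine ⟨fun k i => ?_, fun k => ?_, shareTdMinus h.T_eq h.dm_eq, fun k => ?_, fun k => ?_⟩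
  · rw [toAction_T, toAction_T]
    rfl
  · rw [toAction_dMinus, toAction_dMinus]
    rfl
  · rw [toAction_dPlus, toAction_y, toAction_dPlus, homogeneous_mul, ← homogeneous_smul]
    rfl
  · rw [toAction_dPlus, toAction_y, toAction_dPlus, homogeneous_mul,
      ← neg_one_smul Qqt (homogeneous (R.y k 0 ∘ₗ S.dp k)), ← homogeneous_smul]
    rfl

end Rep

/-! ### The tree of replications -/

/-- A correctly intertwined pair. -/
structure IntertwinedPair where
  fst : Rep V q
  snd : Rep V q⁻¹
  intertwined : Rep.Intertwined t fst snd

namespace IntertwinedPair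

/-- Replace the second member of a pair by the mediant. -/
def left (P : IntertwinedPair) : IntertwinedPair :=
  ⟨P.fst, P.intertwined.replicate₂, P.intertwined.intertwined_replicate₂⟩

/-- Replace the first member of a pair by the mediant. -/
def right (P : IntertwinedPair) : IntertwinedPair :=
  ⟨P.intertwined.replicate₁, P.snd, P.intertwined.intertwined_replicate₁⟩

theorem twist_left (P : IntertwinedPair) : P.left.snd.twist q_inv_mul_q = P.right.fst := by
  change P.intertwined.replicate₂.twist q_inv_mul_q = P.intertwined.replicate₁
  rw [← P.intertwined.twist_replicate₁ t_ne_zero q_mul_q_inv, Rep.twist_twist]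

theorem twist_right (P : IntertwinedPair) : P.right.fst.twist q_mul_q_inv = P.left.snd :=
  P.intertwined.twist_replicate₁ t_ne_zero q_mul_q_inv

/-- The representations with coordinates `(a, b)` with respect to a pair. -/
def search (P : IntertwinedPair) (a b : ℕ) : Rep V q × Rep V q⁻¹ :=
  -- Coprime coordinates with `a = 0` have `b = 1`, so the second basis vector itself is reached;
  -- its missing half is the twist. Other values of `b` are defaults.
  if a = 0 then (P.snd.twist q_inv_mul_q, P.snd)
  else if b = 0 then (P.fst, P.fst.twist q_mul_q_inv)
  -- Change of basis: with basis vectors $e,f$, $ae+bf=(a-b)e+b(e+f)$, and symmetrically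
  -- $ae+bf=a(e+f)+(b-a)f$ below.
  else if b ≤ a then search P.left (a - b) b
  else search P.right a (b - a)
termination_by a + b

theorem search_zero_left (P : IntertwinedPair) (b : ℕ) :
    P.search 0 b = (P.snd.twist q_inv_mul_q, P.snd) := by rw [search, if_pos rfl]

theorem search_zero_right (P : IntertwinedPair) {a : ℕ} (ha : a ≠ 0) :
    P.search a 0 = (P.fst, P.fst.twist q_mul_q_inv) := by rw [search, if_neg ha, if_pos rfl]

theorem search_snd (P : IntertwinedPair) (a b : ℕ) :
    (P.search a b).2 = (P.search a b).1.twist q_mul_q_inv := by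
  induction P, a, b using search.induct with
  | case1 P b => rw [search_zero_left, Rep.twist_twist]
  | case2 P a ha => rw [search_zero_right P ha]
  | case3 P a b ha hb hab ih => rw [search, if_neg ha, if_neg hb, if_pos hab, ih]
  | case4 P a b ha hb hab ih => rw [search, if_neg ha, if_neg hb, if_neg hab, ih]

theorem search_left (P : IntertwinedPair) {a b : ℕ} (ha : a ≠ 0) (h : b ≤ a) :
    P.search a b = P.left.search (a - b) b := by
  by_cases hb : b = 0
  · subst hb
    rw [search_zero_right P ha, Nat.sub_zero, search_zero_right _ ha]
    rfl
  · rw [search, if_neg ha, if_neg hb, if_pos h]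

/-- The definition breaks the tie $a=b$ to the left. Coprimality leaves only $(1,1)$, the mediant,
which both children contain, and there the two answers agree because the replicates are twists of
each other. -/
theorem search_right (P : IntertwinedPair) {a b : ℕ} (hb : b ≠ 0) (h : a ≤ b)
    (hab : Nat.Coprime a b) : P.search a b = P.right.search a (b - a) := by
  by_cases ha : a = 0
  · subst ha
    rw [search_zero_left, search_zero_left]
    rfl
  by_cases h1 : a = b
  · subst h1
    obtain rfl : a = 1 := by simpa using hab
    rw [search, if_neg ha, if_neg hb, if_pos h, Nat.sub_self, search_zero_left,
      search_zero_right _ one_ne_zero, twist_left, twist_right]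
  · rw [search, if_neg ha, if_neg hb, if_neg (by omega)]

/-- Unless the two vectors are $(1,0)$ and $(0,1)$, determinant one forces them onto the same side
of the mediant, ties included. Both, and hence their sum, then descend to the same child with
smaller coordinates. At the end the current node is the required pair and the sum is its mediant. -/
theorem search_unimodular (N : ℕ) : ∀ (P : IntertwinedPair) (a b a' b' : ℕ),
    a + b + a' + b' ≤ N → a * b' = a' * b + 1 → ∃ Q : IntertwinedPair,
    (P.search a b).1 = Q.fst ∧ (P.search a' b').2 = Q.snd ∧
    P.search (a + a') (b + b') = (Q.right.fst, Q.left.snd) := by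
  induction N with
  | zero =>
    intro P a b a' b' h hd
    have : a = 0 := by omega
    subst this
    omega
  | succ N ih =>
    intro P a b a' b' h hd
    have hc : Nat.Coprime a b := by
      rw [Nat.coprime_iff_isRelPrime]
      intro d h1 h2
      have h3 := (Nat.dvd_add_right (h2.mul_left a')).1 (hd ▸ h1.mul_right b')
      exact isUnit_of_dvd_one h3
    have hc' : Nat.Coprime a' b' := by
      rw [Nat.coprime_iff_isRelPrime]
      intro d h1 h2
      have h3 := (Nat.dvd_add_right (h1.mul_right b)).1 (hd ▸ h2.mul_left a)
      exact isUnit_of_dvd_one h3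
    have hcs : Nat.Coprime (a + a') (b + b') := by
      rw [Nat.coprime_iff_isRelPrime]
      intro d h1 h2
      have h4 : a * (b + b') = (a + a') * b + 1 := by linarith
      have h3 := (Nat.dvd_add_right (h1.mul_right b)).1 (h4 ▸ h2.mul_left a)
      exact isUnit_of_dvd_one h3
    have ha : a ≠ 0 := by rintro rfl; omega
    have hb' : b' ≠ 0 := by rintro rfl; omega
    by_cases h0 : b = 0 ∧ a' = 0
    · obtain ⟨rfl, rfl⟩ := h0
      obtain ⟨rfl, rfl⟩ : a = 1 ∧ b' = 1 := by simpa using hd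
      refine ⟨P, ?_, ?_, ?_⟩
      · rw [search_zero_right _ one_ne_zero]
      · rw [search_zero_left]
      · rw [search_left _ (by simp) (by simp)]
        simp only [add_zero, zero_add, Nat.sub_self]
        rw [search_zero_left, twist_left]
    by_cases hle : b ≤ a ∧ b' ≤ a'
    · obtain ⟨h1, h2⟩ := hle
      obtain ⟨c, rfl⟩ := Nat.exists_eq_add_of_le h1
      obtain ⟨c', rfl⟩ := Nat.exists_eq_add_of_le h2
      obtain ⟨Q, hQ1, hQ2, hQ3⟩ := ih P.left c b c' b' (by omega) (by linarith)
      refine ⟨Q, ?_, ?_, ?_⟩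
      · rw [search_left _ ha h1, Nat.add_sub_cancel_left, hQ1]
      · rw [search_left _ (by omega) h2, Nat.add_sub_cancel_left, hQ2]
      · rw [search_left _ (by omega) (by omega), ← hQ3]
        congr 1
        omega
    · have h3 : a ≤ b ∧ a' ≤ b' := by
        rw [not_and_or, not_le, not_le] at hle
        by_contra hcon
        rw [not_and_or, not_le, not_le] at hcon
        -- Strictly on opposite sides, $ab'\ge(b+1)(a'+1)=a'b+1+a'+b$, so $a'+b=0$. In the reversed
        -- arrangements below the determinant would not be positive.
        have key : (b < a ∧ a' < b') → b = 0 ∧ a' = 0 := fun ⟨h1, h2⟩ => by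
          have : (b + 1) * (a' + 1) ≤ a * b' := Nat.mul_le_mul h1 h2
          have h5 : b + a' + (a' * b + 1) ≤ a * b' := by linarith
          omega
        have key2 : ¬ (a < b ∧ b' < a') := fun ⟨h1, h2⟩ => by
          have : a * b' ≤ a' * b := by
            rw [mul_comm a' b]; exact Nat.mul_le_mul h1.le h2.le
          omega
        have key3 : ¬ (a < b ∧ b' ≤ a') := fun ⟨h1, h2⟩ => by
          have : a * b' ≤ a' * b := by
            rw [mul_comm a' b]; exact Nat.mul_le_mul h1.le h2
          omega
        have key4 : ¬ (a ≤ b ∧ b' ≤ a') := fun ⟨h1, h2⟩ => by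
          have : a * b' ≤ a' * b := by
            rw [mul_comm a' b]; exact Nat.mul_le_mul h1 h2
          omega
        omega
      obtain ⟨h1, h2⟩ := h3
      obtain ⟨c, rfl⟩ := Nat.exists_eq_add_of_le h1
      obtain ⟨c', rfl⟩ := Nat.exists_eq_add_of_le h2
      obtain ⟨Q, hQ1, hQ2, hQ3⟩ := ih P.right a c a' c' (by omega) (by linarith)
      refine ⟨Q, ?_, ?_, ?_⟩
      · rw [search_right _ (by omega) h1 hc, Nat.add_sub_cancel_left, hQ1]
      · rw [search_right _ hb' h2 hc', Nat.add_sub_cancel_left, hQ2]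
      · rw [search_right _ (by omega) (by omega) hcs, ← hQ3]
        congr 1
        omega

end IntertwinedPair

theorem exists_actions (P : IntertwinedPair)
    (h1 : IsFirstBasic (P.fst.toAction algebraMap_q₀))
    (h2 : IsSecondBasic (P.snd.toAction algebraMap_q₀_inv)) :
    ∃ (ρ : ∀ m n : ℕ, Nat.Coprime m n → Action q₀) (ρs : ∀ m n : ℕ, Nat.Coprime m n → Action q₀⁻¹),
      IsFirstBasic (ρ 0 1 (Nat.coprime_one_right 0)) ∧
      IsSecondBasic (ρs 1 0 (Nat.coprime_one_left 0)) ∧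
      (∀ (m n : ℕ) (h : Nat.Coprime m n), ShareTdMinus (ρ m n h) (ρs m n h) ∧
        ∀ k : ℕ, (ρ m n h).dPlus k = -q ^ k • (ρs m n h).dPlus k) ∧
      (∀ (m n m' n' : ℕ) (h : Nat.Coprime m n) (h' : Nat.Coprime m' n')
        (h'' : Nat.Coprime (m + m') (n + n')), (m' : ℤ) * n - m * n' = 1 →
          CorrectlyIntertwined (ρ m n h) (ρs m' n' h') ∧
          IsReplication (ρ m n h) (ρs m' n' h')
            (ρ (m + m') (n + n') h'') (ρs (m + m') (n + n') h'')) := by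
  -- The coordinates are swapped: the first basic representation sits at $(m,n)=(0,1)$, so $n$ is
  -- the coordinate along it.
  refine ⟨fun m n _ => Rep.toAction (P.search n m).1 algebraMap_q₀,
    fun m n _ => Rep.toAction (P.search n m).2 algebraMap_q₀_inv, ?_, ?_, ?_, ?_⟩
  · simpa only [P.search_zero_right one_ne_zero]
  · simpa only [P.search_zero_left]
  · intro m n _
    simp only [P.search_snd]
    refine ⟨Rep.shareTdMinus (fun _ _ => rfl) fun _ => rfl, fun k => ?_⟩
    rw [Rep.toAction_dPlus, Rep.toAction_dPlus, ← homogeneous_smul, Rep.twist_dp, smul_smul,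
      neg_mul_neg, ← mul_pow, q_mul_q_inv, one_pow, one_smul]
  · intro m n m' n' _ _ _ hd
    have hd' : n * m' = n' * m + 1 := by
      zify
      linarith
    obtain ⟨Q, hQ1, hQ2, hQ3⟩ := P.search_unimodular _ n m n' m' le_rfl hd'
    simp only [hQ1, hQ2, hQ3]
    exact ⟨Q.intertwined.correctlyIntertwined, Q.intertwined.isReplication⟩

/-! ### The plethystic exponential -/

section PlethysticExp

open PowerSeries

/-- The coefficient of `w ^ j` in `Exp[-w X]`. -/
def h (j : ℕ) : Sym := coeff j expNeg

/-- The logarithm of `Exp[-w X]`. -/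
def logExpNeg : PowerSeries Sym :=
  PowerSeries.mk fun n => if h : 0 < n then -((n : Qqt)⁻¹ • p ⟨n, h⟩) else 0

theorem hasSubst_logExpNeg : HasSubst logExpNeg :=
  HasSubst.of_constantCoeff_zero' (by simp [logExpNeg])

theorem expNeg_eq_subst : expNeg = (PowerSeries.exp Sym).subst logExpNeg := rfl

theorem derivative_logExpNeg :
    derivative Sym logExpNeg = -PowerSeries.mk fun n => p n.succPNat := by
  ext1 n
  have hn : ((n + 1 : ℕ) : Qqt) ≠ 0 := Nat.cast_ne_zero.2 n.succ_ne_zero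
  have h1 : ((n : Sym) + 1) = algebraMap Qqt Sym ((n + 1 : ℕ) : Qqt) := by
    rw [map_natCast]; push_cast; rfl
  rw [coeff_derivative, logExpNeg, coeff_mk, dif_pos n.succ_pos, map_neg, coeff_mk, neg_mul, h1,
    mul_comm, ← Algebra.smul_def, smul_inv_smul₀ hn]
  rfl

/-- Logarithmic differentiation. These are Newton's identities, since the coefficients of `expNeg`
are $(-1)^je_j$. -/
theorem derivative_expNeg :
    derivative Sym expNeg = -(PowerSeries.mk fun n => p n.succPNat) * expNeg := by
  rw [expNeg_eq_subst, derivative_subst hasSubst_logExpNeg, derivative_exp, derivative_logExpNeg,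
    mul_comm]

theorem h_zero : h 0 = 1 := by
  rw [h, expNeg_eq_subst, coeff_subst' hasSubst_logExpNeg, finsum_eq_single _ 0]
  · simp
  · intro n hn
    simp [logExpNeg, hn]

variable {A : Type*} [CommRing A] [Algebra Qqt A]

theorem map_derivative {A : Type*} [CommRing A] (f : Sym →+* A) (F : PowerSeries Sym) :
    PowerSeries.map f (derivative Sym F) = derivative A (PowerSeries.map f F) := by
  ext1 n
  simp [coeff_derivative]

/-- Up to a nonzero integer, each coefficient of `D` is a combination of earlier ones. -/
theorem eq_zero_of_derivative_eq_mul (D G : PowerSeries A) (h0 : coeff 0 D = 0)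
    (hD : derivative A D = G * D) : D = 0 := by
  ext1 n
  induction n using Nat.strong_induction_on with
  | _ n ih =>
    obtain _ | n := n
    · simpa using h0
    have h1 := congrArg (coeff n) hD
    rw [coeff_derivative, coeff_mul, Finset.sum_eq_zero] at h1
    · have hn : ((n + 1 : ℕ) : Qqt) ≠ 0 := Nat.cast_ne_zero.2 n.succ_ne_zero
      have h2 : ((n : A) + 1) = algebraMap Qqt A ((n + 1 : ℕ) : Qqt) := by
        rw [map_natCast]; push_cast; rfl
      rw [h2, mul_comm, ← Algebra.smul_def, smul_eq_zero_iff_right hn] at h1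
      simpa using h1
    · intro x hx
      rw [ih _ (by have := Finset.HasAntidiagonal.mem_antidiagonal.1 hx; omega), map_zero, mul_zero]

theorem mk_pow_mul_one_sub {A : Type*} [CommRing A] (y : A) :
    PowerSeries.mk (fun n => y ^ n) * (1 - C y * X) = 1 := by
  ext1 n
  obtain _ | n := n
  · simp
  · rw [mul_sub, mul_one, map_sub, ← mul_assoc, coeff_succ_mul_X, coeff_mk, coeff_mul_C, coeff_mk,
      coeff_one, if_neg n.succ_ne_zero, pow_succ, sub_self]

/-- The effect on `Exp[-w X]` of the substitution `X ↦ X + (q - 1) y`. -/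
theorem map_h_succ (θ ι : Sym →ₐ[Qqt] A) (y : A)
    (hθ : ∀ n : ℕ+, θ (p n) = ι (p n) + (q ^ (n : ℕ) - 1) • y ^ (n : ℕ)) (a : ℕ) :
    θ (h (a + 1)) - y * θ (h a) = ι (h (a + 1)) - q • y * ι (h a) := by
  set P : PowerSeries A := PowerSeries.mk fun n => ι (p n.succPNat) with hP
  set E₁ : PowerSeries A := PowerSeries.mk fun n => (q • y) ^ n with hE₁
  set E₂ : PowerSeries A := PowerSeries.mk fun n => y ^ n with hE₂
  have e₁ : E₁ * (1 - C (q • y) * X) = 1 := mk_pow_mul_one_sub _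
  have e₂ : E₂ * (1 - C y * X) = 1 := mk_pow_mul_one_sub _
  set Hθ := PowerSeries.map (θ : Sym →+* A) expNeg with hHθ
  set Hι := PowerSeries.map (ι : Sym →+* A) expNeg with hHι
  have d₁ : derivative A Hθ = -(P + C (q • y) * E₁ - C y * E₂) * Hθ := by
    rw [hHθ, ← map_derivative, derivative_expNeg, map_mul, map_neg]
    congr 2
    ext1 n
    simp only [hP, hE₁, hE₂, coeff_map, coeff_mk, map_sub, map_add, coeff_C_mul]
    simp only [RingHom.coe_coe, hθ, Nat.succPNat_coe, Nat.succ_eq_add_one, sub_smul, one_smul,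
      ← pow_succ']
    rw [smul_pow]
    abel
  have d₂ : derivative A Hι = -P * Hι := by
    rw [hHι, ← map_derivative, derivative_expNeg, map_mul, map_neg]
    congr 2
  have dl : ∀ z : A, derivative A (1 - C z * X) = -C z := fun z => by
    ext1 n
    rw [coeff_derivative, map_sub, coeff_succ_mul_X, coeff_one, if_neg n.succ_ne_zero, zero_sub,
      map_neg, coeff_C]
    split_ifs with hn
    · simp [hn]
    · simp
  -- Both products satisfy the linear equation $D'=-(P+qyE_1)D$ with constant term $1$: the factors
  -- $1-yw$ and $1-qyw$ absorb the geometric series in the logarithmic derivatives.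
  have key : Hθ * (1 - C y * X) - Hι * (1 - C (q • y) * X) = 0 := by
    refine eq_zero_of_derivative_eq_mul _ (-(P + C (q • y) * E₁)) ?_ ?_
    · have h0 : ∀ f : Sym →+* A, constantCoeff (PowerSeries.map f expNeg) = 1 := fun f => by
        rw [← coeff_zero_eq_constantCoeff_apply, coeff_map]
        exact (congrArg f h_zero).trans (map_one f)
      simp [hHθ, hHι, mul_sub, ← mul_assoc, h0]
    · rw [map_sub, Derivation.leibniz, Derivation.leibniz, dl, dl, d₁, d₂]
      simp only [smul_eq_mul]
      linear_combination (C y * Hθ) * e₂ - (C (q • y) * Hι) * e₁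
  have h1 := congrArg (coeff (a + 1)) key
  rw [mul_sub, mul_sub, mul_one, mul_one, ← mul_assoc, ← mul_assoc, map_sub, map_sub, map_sub,
    coeff_succ_mul_X, coeff_succ_mul_X, coeff_mul_C, coeff_mul_C, map_zero, sub_eq_zero, hHθ, hHι,
    coeff_map, coeff_map, coeff_map, coeff_map] at h1
  rw [mul_comm y, mul_comm (q • y)]
  exact h1

end PlethysticExp

/-! ### Substitutions -/

section Substitutions

theorem ofSym_p (k : ℕ) (n : ℕ+) : ofSym k (p n) = MvPolynomial.X (Sum.inl n) := by
  simp [ofSym, p]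

theorem shiftPlus_yVar {k : ℕ} (i : Fin k) : shiftPlus k (yVar i) = yVar i.castSucc := by
  simp [shiftPlus, yVar]

theorem shiftPlus_ofSym_p (k : ℕ) (n : ℕ+) : shiftPlus k (ofSym k (p n)) =
    ofSym (k + 1) (p n) + (q ^ (n : ℕ) - 1) • yVar (Fin.last k) ^ (n : ℕ) := by
  simp [shiftPlus, ofSym_p k]

theorem algHom_ext_V {k : ℕ} {A : Type*} [CommSemiring A] [Algebra Qqt A] {f g : V k →ₐ[Qqt] A}
    (hp : ∀ n, f (ofSym k (p n)) = g (ofSym k (p n))) (hy : ∀ i, f (yVar i) = g (yVar i)) :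
    f = g := by
  refine MvPolynomial.algHom_ext fun i => ?_
  obtain n | i := i
  · simpa only [ofSym_p] using hp n
  · exact hy i

theorem shiftMinus_yVar_last (k : ℕ) : shiftMinus k (yVar (Fin.last k)) = Polynomial.X := by
  simp [shiftMinus, yVar]

theorem shiftMinus_yVar_castSucc {k : ℕ} (i : Fin k) :
    shiftMinus k (yVar i.castSucc) = Polynomial.C (yVar i) := by
  simp [shiftMinus, yVar]

theorem shiftMinus_ofSym_p (k : ℕ) (n : ℕ+) : shiftMinus k (ofSym (k + 1) (p n)) =
    Polynomial.C (ofSym k (p n)) - (q ^ (n : ℕ) - 1) • Polynomial.X ^ (n : ℕ) := by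
  simp [shiftMinus, ofSym_p (k + 1)]

/-- Together with `eval₂_shiftMinus` this identifies $V_{k+1}$ with $V_k[y_{k+1}]$, with $V_k$
embedded by `shiftPlus` rather than by the obvious inclusion. -/
theorem shiftMinus_shiftPlus (k : ℕ) (F : V k) : shiftMinus k (shiftPlus k F) = Polynomial.C F := by
  have h : (shiftMinus k).comp (shiftPlus k) = Polynomial.CAlgHom := by
    refine algHom_ext_V (fun n => ?_) fun i => ?_
    · rw [AlgHom.comp_apply, shiftPlus_ofSym_p, map_add, map_smul, map_pow,
        shiftMinus_yVar_last, shiftMinus_ofSym_p, sub_add_cancel]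
      rfl
    · rw [AlgHom.comp_apply, shiftPlus_yVar, shiftMinus_yVar_castSucc]
      rfl
  exact DFunLike.congr_fun h F

theorem eval₂_shiftMinus (k : ℕ) (F : V (k + 1)) :
    Polynomial.eval₂ (shiftPlus k : V k →+* V (k + 1)) (yVar (Fin.last k)) (shiftMinus k F) = F := by
  let e : Polynomial (V k) →ₐ[Qqt] V (k + 1) :=
    { Polynomial.eval₂RingHom (shiftPlus k : V k →+* V (k + 1)) (yVar (Fin.last k)) with
      commutes' := fun r => by
        change Polynomial.eval₂ _ _ (Polynomial.C (algebraMap Qqt (V k) r)) = _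
        rw [Polynomial.eval₂_C]
        exact (shiftPlus k).commutes r }
  have eC : ∀ G, e (Polynomial.C G) = shiftPlus k G := fun G => Polynomial.eval₂_C _ _
  have eX : e Polynomial.X = yVar (Fin.last k) := Polynomial.eval₂_X _ _
  have h : e.comp (shiftMinus k) = AlgHom.id Qqt (V (k + 1)) := by
    refine algHom_ext_V (fun n => ?_) fun i => ?_
    · rw [AlgHom.comp_apply, shiftMinus_ofSym_p, map_sub, map_smul, map_pow, eC, eX,
        shiftPlus_ofSym_p, add_sub_cancel_right]
      rfl
    · rw [AlgHom.comp_apply]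
      induction i using Fin.lastCases with
      | last => rw [shiftMinus_yVar_last, eX]; rfl
      | cast i => rw [shiftMinus_yVar_castSucc, eC, shiftPlus_yVar]; rfl
  exact DFunLike.congr_fun h F

theorem V_induction {k : ℕ} {P : V (k + 1) → Prop} (F : V (k + 1))
    (add : ∀ F G, P F → P G → P (F + G))
    (mul : ∀ j G, P (yVar (Fin.last k) ^ j * shiftPlus k G)) : P F := by
  rw [← eval₂_shiftMinus k F]
  induction shiftMinus k F using Polynomial.induction_on' with
  | add f g hf hg => rw [Polynomial.eval₂_add]; exact add _ _ hf hg
  | monomial n a =>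
    rw [Polynomial.eval₂_monomial, mul_comm]
    exact mul n a

theorem V_induction' {k : ℕ} {P : V (k + 1) → Prop} (F : V (k + 1))
    (add : ∀ F G, P F → P G → P (F + G)) (base : ∀ G, P (shiftPlus k G))
    (mul : ∀ F, P F → P (yVar (Fin.last k) * F)) : P F := by
  refine V_induction F add fun j G => ?_
  induction j with
  | zero => simpa using base G
  | succ j ih => rw [pow_succ', mul_assoc]; exact mul _ ih

/-- The substitution inside $d_-$ undoes `shiftPlus`, so only the extraction of the constant term
remains. Such products span $V_{k+1}$, so relations for $d_-$ can be checked on them. -/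
theorem dMinus_pow_mul_shiftPlus (k j : ℕ) (G : V k) :
    dMinus k (yVar (Fin.last k) ^ j * shiftPlus k G) = ofSym k (h j) * G := by
  rw [dMinus, LinearMap.comp_apply, AlgHom.toLinearMap_apply, map_mul, map_pow,
    shiftMinus_yVar_last, shiftMinus_shiftPlus, mul_comm, Polynomial.C_mul_X_pow_eq_monomial,
    Polynomial.lsum_apply, Polynomial.sum_monomial_index _ _ (by simp)]
  simp [h, mul_comm]

theorem dMinus_shiftPlus_mul (k : ℕ) (G : V k) (F : V (k + 1)) :
    dMinus k (shiftPlus k G * F) = G * dMinus k F := by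
  induction F using V_induction with
  | add F F' hF hF' => rw [mul_add, map_add, map_add, mul_add, hF, hF']
  | mul j G' =>
    rw [mul_left_comm, ← map_mul, dMinus_pow_mul_shiftPlus, dMinus_pow_mul_shiftPlus]
    ring

theorem dMinus_shiftPlus (k : ℕ) (G : V k) : dMinus k (shiftPlus k G) = G := by
  have h := dMinus_pow_mul_shiftPlus k 0 G
  rwa [pow_zero, one_mul, h_zero, map_one, one_mul] at h

theorem dMinus_pow (k j : ℕ) : dMinus k (yVar (Fin.last k) ^ j) = ofSym k (h j) := by
  have h := dMinus_pow_mul_shiftPlus k j 1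
  rwa [map_one, mul_one, mul_one] at h

theorem dMinus_yVar_mul (k : ℕ) (i : Fin k) (F : V (k + 1)) :
    dMinus k (yVar i.castSucc * F) = yVar i * dMinus k F := by
  rw [← shiftPlus_yVar, dMinus_shiftPlus_mul]

theorem shiftPlus_h_succ (k a : ℕ) :
    shiftPlus k (ofSym k (h (a + 1))) - yVar (Fin.last k) * shiftPlus k (ofSym k (h a)) =
      ofSym (k + 1) (h (a + 1)) - q • yVar (Fin.last k) * ofSym (k + 1) (h a) :=
  map_h_succ ((shiftPlus k).comp (ofSym k)) (ofSym (k + 1)) _ (shiftPlus_ofSym_p k) a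

/-- The operator `d₊*` as a homomorphism of algebras. -/
def dStar (k : ℕ) : V k →ₐ[Qqt] V (k + 1) := (γ k).comp (shiftPlus k)

theorem dPlusStar_apply (k : ℕ) (F : V k) : dPlusStar k F = dStar k F := rfl

theorem dStar_yVar {k : ℕ} (i : Fin k) : dStar k (yVar i) = yVar i.succ := by
  rw [dStar, AlgHom.comp_apply, shiftPlus_yVar]
  simp [γ, yVar]

theorem dStar_ofSym_p (k : ℕ) (n : ℕ+) : dStar k (ofSym k (p n)) =
    ofSym (k + 1) (p n) + (q ^ (n : ℕ) - 1) • (t • yVar 0) ^ (n : ℕ) := by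
  rw [dStar, AlgHom.comp_apply, shiftPlus_ofSym_p, map_add, map_smul, map_pow]
  simp [γ, ofSym_p (k + 1), yVar]

theorem dStar_h_succ (k a : ℕ) :
    dStar k (ofSym k (h (a + 1))) - (t • yVar 0) * dStar k (ofSym k (h a)) =
      ofSym (k + 1) (h (a + 1)) - q • (t • yVar 0) * ofSym (k + 1) (h a) :=
  map_h_succ ((dStar k).comp (ofSym k)) (ofSym (k + 1)) _ (dStar_ofSym_p k) a

theorem dStar_shiftPlus (k : ℕ) (F : V k) :
    dStar (k + 1) (shiftPlus k F) = shiftPlus (k + 1) (dStar k F) := by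
  have h : (dStar (k + 1)).comp (shiftPlus k) = (shiftPlus (k + 1)).comp (dStar k) := by
    refine algHom_ext_V (fun n => ?_) fun i => ?_
    · simp only [AlgHom.comp_apply, shiftPlus_ofSym_p, dStar_ofSym_p, map_add, map_smul, map_pow,
        dStar_yVar, shiftPlus_yVar, Fin.succ_last, Fin.castSucc_zero]
      abel
    · simp only [AlgHom.comp_apply, shiftPlus_yVar, dStar_yVar, Fin.succ_castSucc]
  exact DFunLike.congr_fun h F

/-- The operator `d₊* d₋ - d₋ d₊*`. -/
theorem bracketStar_shiftPlus (k : ℕ) (G : V k) :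
    bracket dMinus dPlusStar k (shiftPlus k G) = 0 := by
  rw [bracket_apply, dMinus_shiftPlus, dPlusStar_apply, dPlusStar_apply, dStar_shiftPlus,
    dMinus_shiftPlus, sub_self]

/-- On $y_{k+1}^jG$, with $G$ shifted, the bracket measures how `h j` changes under $X\mapsto
X+(q-1)ty_1$, so this is the recursion `dStar_h_succ`. With the vanishing above it determines the
bracket by induction on $j$. -/
theorem bracketStar_yVar_last_mul (k : ℕ) (F : V (k + 1)) :
    bracket dMinus dPlusStar k (yVar (Fin.last k) * F) =
      (t • yVar 0) * (bracket dMinus dPlusStar k F +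
        (1 - q) • dMinus (k + 1) (dPlusStar (k + 1) F)) := by
  induction F using V_induction with
  | add F F' hF hF' =>
    rw [mul_add, map_add, hF, hF', map_add, map_add, map_add, smul_add]
    ring
  | mul j G =>
    have h1 : ∀ j, bracket dMinus dPlusStar k (yVar (Fin.last k) ^ j * shiftPlus k G) =
        dStar k G * (dStar k (ofSym k (h j)) - ofSym (k + 1) (h j)) := fun j => by
      rw [bracket_apply, dMinus_pow_mul_shiftPlus, dPlusStar_apply, dPlusStar_apply, map_mul,
        map_mul, map_pow, dStar_yVar, dStar_shiftPlus, Fin.succ_last, dMinus_pow_mul_shiftPlus]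
      ring
    have h2 := dStar_h_succ k j
    rw [← mul_assoc, ← pow_succ', h1, h1, dPlusStar_apply, map_mul, map_pow, dStar_yVar,
      dStar_shiftPlus, Fin.succ_last, dMinus_pow_mul_shiftPlus]
    simp only [Algebra.smul_def, map_sub, map_one] at h2 ⊢
    linear_combination (dStar k G) * h2

theorem bracketStar_yVar_mul (k : ℕ) (i : Fin (k + 1)) (F : V (k + 2)) :
    bracket dMinus dPlusStar (k + 1) (yVar i.castSucc * F) =
      yVar i.succ * bracket dMinus dPlusStar (k + 1) F := by
  simp only [bracket_apply, dPlusStar_apply, dMinus_yVar_mul, map_mul, dStar_yVar, mul_sub]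
  rw [← dMinus_yVar_mul, Fin.castSucc_succ]

end Substitutions

/-! ### The operators `T_i` -/

section Hecke

theorem swap_yVar_castSucc (k : ℕ) (i : Fin k) : swap k i (yVar i.castSucc) = yVar i.succ := by
  simp [swap, yVar]

theorem swap_yVar_succ (k : ℕ) (i : Fin k) : swap k i (yVar i.succ) = yVar i.castSucc := by
  simp [swap, yVar]

theorem swap_yVar_of_ne {k : ℕ} {i : Fin k} {j : Fin (k + 1)} (h1 : j ≠ i.castSucc)
    (h2 : j ≠ i.succ) : swap k i (yVar j) = yVar j := by
  simp [swap, yVar, Equiv.swap_apply_of_ne_of_ne h1 h2]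

theorem swap_yVar (k : ℕ) (i : Fin k) (j : Fin (k + 1)) :
    swap k i (yVar j) = yVar (Equiv.swap i.castSucc i.succ j) := by
  simp [swap, yVar]

theorem swap_ofSym_p (k : ℕ) (i : Fin k) (n : ℕ+) :
    swap k i (ofSym (k + 1) (p n)) = ofSym (k + 1) (p n) := by
  simp [swap, ofSym_p (k + 1)]

theorem swap_swap (k : ℕ) (i : Fin k) (F : V (k + 1)) : swap k i (swap k i F) = F := by
  have h : (swap k i).comp (swap k i) = AlgHom.id Qqt (V (k + 1)) := by
    refine algHom_ext_V (fun n => ?_) fun j => ?_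
    · simp [swap_ofSym_p]
    · simp [swap_yVar]
  exact DFunLike.congr_fun h F

theorem heckeDen_mul_hecke' (k : ℕ) (i : Fin k) (F : V (k + 1)) :
    (yVar i.succ - yVar i.castSucc) * hecke k i F =
      (MvPolynomial.C q - 1) * yVar i.castSucc * F +
        (yVar i.succ - MvPolynomial.C q * yVar i.castSucc) * swap k i F := by
  rw [← heckeDen, heckeDen_mul_hecke, heckeNum]
  simp only [Algebra.smul_def, map_sub, map_one, MvPolynomial.algebraMap_eq]
  ring

/-- Characterises $T_iF$ without division: the denominator is a nonzero element of a domain. -/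
theorem hecke_eq_iff {k : ℕ} {i : Fin k} {F G : V (k + 1)} : hecke k i F = G ↔
    (yVar i.succ - yVar i.castSucc) * G =
      (MvPolynomial.C q - 1) * yVar i.castSucc * F +
        (yVar i.succ - MvPolynomial.C q * yVar i.castSucc) * swap k i F := by
  rw [← heckeDen_mul_hecke', ← heckeDen]
  exact ⟨fun h => by rw [h], fun h => (mul_left_cancel₀ (heckeDen_ne_zero k i) h).symm⟩

theorem hecke_mul_of_symm {k : ℕ} {i : Fin k} {G : V (k + 1)} (hG : swap k i G = G)
    (F : V (k + 1)) : hecke k i (G * F) = G * hecke k i F := by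
  rw [hecke_eq_iff, map_mul, hG]
  linear_combination G * heckeDen_mul_hecke' k i F

theorem hecke_one (k : ℕ) (i : Fin k) : hecke k i 1 = 1 := by
  rw [hecke_eq_iff, map_one]
  ring

theorem hecke_of_symm {k : ℕ} {i : Fin k} {G : V (k + 1)} (hG : swap k i G = G) :
    hecke k i G = G := by
  have h := hecke_mul_of_symm hG 1
  rwa [hecke_one, mul_one] at h

theorem hecke_yVar_succ_mul (k : ℕ) (i : Fin k) (F : V (k + 1)) :
    hecke k i (yVar i.succ * F) = yVar i.castSucc * (hecke k i F + (q - 1) • F) := by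
  rw [hecke_eq_iff, map_mul, swap_yVar_succ]
  simp only [Algebra.smul_def, map_sub, map_one, MvPolynomial.algebraMap_eq]
  linear_combination yVar i.castSucc * heckeDen_mul_hecke' k i F

theorem hecke_yVar_castSucc_mul (k : ℕ) (i : Fin k) (F : V (k + 1)) :
    hecke k i (yVar i.castSucc * F) = yVar i.castSucc * hecke k i F +
      (yVar i.succ - q • yVar i.castSucc) * swap k i F := by
  rw [hecke_eq_iff, map_mul, swap_yVar_castSucc]
  simp only [Algebra.smul_def, MvPolynomial.algebraMap_eq]
  linear_combination yVar i.castSucc * heckeDen_mul_hecke' k i F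

theorem hecke_hecke (k : ℕ) (i : Fin k) (F : V (k + 1)) :
    hecke k i (hecke k i F) = (1 - q) • hecke k i F + q • F := by
  rw [hecke_eq_iff]
  have h1 := heckeDen_mul_hecke' k i F
  have h2 := congrArg (swap k i) h1
  simp only [map_mul, map_add, map_sub, map_one, swap_yVar_castSucc, swap_yVar_succ, swap_swap,
    MvPolynomial.algHom_C, MvPolynomial.algebraMap_eq] at h2
  apply mul_left_cancel₀ (heckeDen_ne_zero k i)
  rw [heckeDen]
  simp only [Algebra.smul_def, map_sub, map_one, MvPolynomial.algebraMap_eq]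
  linear_combination ((1 - MvPolynomial.C q) * yVar i.succ) * h1 +
    (yVar i.succ - MvPolynomial.C q * yVar i.castSucc) * h2

/-- Homomorphisms that intertwine the interchange of variables intertwine the operators `T`. -/
theorem map_hecke {k l : ℕ} {i : Fin k} {j : Fin l} (L : V (k + 1) →ₐ[Qqt] V (l + 1))
    (h1 : L (yVar i.castSucc) = yVar j.castSucc) (h2 : L (yVar i.succ) = yVar j.succ)
    (h3 : ∀ F, L (swap k i F) = swap l j (L F)) (F : V (k + 1)) :
    L (hecke k i F) = hecke l j (L F) := by
  symm
  rw [hecke_eq_iff, ← h1, ← h2, ← h3]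
  have h := congrArg L (heckeDen_mul_hecke' k i F)
  simpa only [map_mul, map_add, map_sub, map_one, MvPolynomial.algHom_C,
    MvPolynomial.algebraMap_eq] using h

theorem shiftPlus_swap (k : ℕ) (i : Fin k) (F : V (k + 1)) :
    shiftPlus (k + 1) (swap k i F) = swap (k + 1) i.castSucc (shiftPlus (k + 1) F) := by
  have h : (shiftPlus (k + 1)).comp (swap k i) =
      (swap (k + 1) i.castSucc).comp (shiftPlus (k + 1)) := by
    refine algHom_ext_V (fun n => ?_) fun j => ?_
    · simp only [AlgHom.comp_apply, swap_ofSym_p, shiftPlus_ofSym_p, map_add, map_smul, map_pow]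
      rw [swap_yVar_of_ne (Fin.castSucc_lt_last _).ne'
        (by rw [← Fin.castSucc_succ]; exact (Fin.castSucc_lt_last _).ne')]
    · simp only [AlgHom.comp_apply, swap_yVar, shiftPlus_yVar]
      congr 1
      rw [← Fin.castSucc_succ]
      exact ((Fin.castSucc_injective _).map_swap _ _ _)
  exact DFunLike.congr_fun h F

theorem dStar_swap (k : ℕ) (i : Fin k) (F : V (k + 1)) :
    dStar (k + 1) (swap k i F) = swap (k + 1) i.succ (dStar (k + 1) F) := by
  have h : (dStar (k + 1)).comp (swap k i) = (swap (k + 1) i.succ).comp (dStar (k + 1)) := by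
    refine algHom_ext_V (fun n => ?_) fun j => ?_
    · simp only [AlgHom.comp_apply, swap_ofSym_p, dStar_ofSym_p, map_add, map_smul, map_pow]
      rw [swap_yVar_of_ne (by simp [Fin.ext_iff]) (by simp [Fin.ext_iff])]
    · simp only [AlgHom.comp_apply, swap_yVar, dStar_yVar]
      congr 1
      rw [← Fin.succ_castSucc]
      exact ((Fin.succ_injective _).map_swap _ _ _)
  exact DFunLike.congr_fun h F

theorem shiftPlus_hecke (k : ℕ) (i : Fin k) (F : V (k + 1)) :
    shiftPlus (k + 1) (hecke k i F) = hecke (k + 1) i.castSucc (shiftPlus (k + 1) F) :=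
  map_hecke _ (shiftPlus_yVar _) (by rw [shiftPlus_yVar, Fin.castSucc_succ])
    (shiftPlus_swap k i) F

theorem dStar_hecke (k : ℕ) (i : Fin k) (F : V (k + 1)) :
    dStar (k + 1) (hecke k i F) = hecke (k + 1) i.succ (dStar (k + 1) F) :=
  map_hecke _ (by rw [dStar_yVar, Fin.succ_castSucc]) (dStar_yVar _) (dStar_swap k i) F

theorem swap_comm {k : ℕ} {i j : Fin k} (h : (i : ℕ) + 1 < j) (F : V (k + 1)) :
    swap k i (swap k j F) = swap k j (swap k i F) := by
  have h : (swap k i).comp (swap k j) = (swap k j).comp (swap k i) := by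
    refine algHom_ext_V (fun n => ?_) fun l => ?_
    · simp only [AlgHom.comp_apply, swap_ofSym_p]
    · simp only [AlgHom.comp_apply, swap_yVar]
      congr 1
      have h4 : Equiv.Perm.Disjoint (Equiv.swap i.castSucc i.succ) (Equiv.swap j.castSucc j.succ) := by
        refine Equiv.Perm.disjoint_swap_swap ?_
        simp [Fin.ext_iff]
        omega
      exact DFunLike.congr_fun h4.commute.eq l
  exact DFunLike.congr_fun h F

theorem hecke_comm {k : ℕ} {i j : Fin k} (h : (i : ℕ) + 1 < j) (F : V (k + 1)) :
    hecke k i (hecke k j F) = hecke k j (hecke k i F) := by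
  have h1 : swap k i (yVar j.castSucc) = yVar j.castSucc :=
    swap_yVar_of_ne (by simp [Fin.ext_iff]; omega) (by simp [Fin.ext_iff]; omega)
  have h2 : swap k i (yVar j.succ) = yVar j.succ :=
    swap_yVar_of_ne (by simp [Fin.ext_iff]; omega) (by simp [Fin.ext_iff]; omega)
  have h3 : swap k j (yVar i.castSucc) = yVar i.castSucc :=
    swap_yVar_of_ne (by simp [Fin.ext_iff]; omega) (by simp [Fin.ext_iff]; omega)
  have h4 : swap k j (yVar i.succ) = yVar i.succ :=
    swap_yVar_of_ne (by simp [Fin.ext_iff]; omega) (by simp [Fin.ext_iff]; omega)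
  symm
  rw [hecke_eq_iff, map_hecke (swap k j) h3 h4 (fun F => (swap_comm h F).symm),
    ← hecke_mul_of_symm (i := i) (by rw [map_sub, h1, h2]),
    ← hecke_mul_of_symm (i := i) (by simp [h1]),
    ← hecke_mul_of_symm (i := i) (by simp [h1, h2]), ← map_add, heckeDen_mul_hecke']

/-- Subscripts record the interchanges applied, so `F₁₂` stands for $s_1s_2F$; $U=T_1F$, $Y=T_2U$,
$W=T_1Y$ and $P=T_2F$, $R=T_1P$, $Z=T_2R$. Eliminating the intermediate quantities writes both sides
through the six translates of $F$, and a rational identity in $a,b,c,q$ remains. -/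
theorem braid_of_den_mul {K : Type*} [Field K] {a b c q F F₁ F₂ F₁₂ F₂₁ F₁₂₁ : K}
    {U U₁ U₂ U₁₂ Y Y₁ W P P₁ P₂ P₂₁ R R₂ Z : K}
    (hab : b - a ≠ 0) (hac : c - a ≠ 0) (hbc : c - b ≠ 0)
    (hU : (b - a) * U = (q - 1) * a * F + (b - q * a) * F₁)
    (hU₂ : (c - a) * U₂ = (q - 1) * a * F₂ + (c - q * a) * F₂₁)
    (hY : (c - b) * Y = (q - 1) * b * U + (c - q * b) * U₂)
    (hU₁ : (a - b) * U₁ = (q - 1) * b * F₁ + (a - q * b) * F)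
    (hU₁₂ : (c - b) * U₁₂ = (q - 1) * b * F₁₂ + (c - q * b) * F₁₂₁)
    (hY₁ : (c - a) * Y₁ = (q - 1) * a * U₁ + (c - q * a) * U₁₂)
    (hW : (b - a) * W = (q - 1) * a * Y + (b - q * a) * Y₁)
    (hP : (c - b) * P = (q - 1) * b * F + (c - q * b) * F₂)
    (hP₁ : (c - a) * P₁ = (q - 1) * a * F₁ + (c - q * a) * F₁₂)
    (hR : (b - a) * R = (q - 1) * a * P + (b - q * a) * P₁)
    (hP₂ : (b - c) * P₂ = (q - 1) * c * F₂ + (b - q * c) * F)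
    (hP₂₁ : (b - a) * P₂₁ = (q - 1) * a * F₂₁ + (b - q * a) * F₁₂₁)
    (hR₂ : (c - a) * R₂ = (q - 1) * a * P₂ + (c - q * a) * P₂₁)
    (hZ : (c - b) * Z = (q - 1) * b * R + (c - q * b) * R₂) : W = Z := by
  have hba : a - b ≠ 0 := by rwa [← neg_sub, neg_ne_zero]
  have hcb : b - c ≠ 0 := by rwa [← neg_sub, neg_ne_zero]
  rw [mul_comm, ← eq_div_iff (by assumption)] at hU hU₂ hY hU₁ hU₁₂ hY₁ hW hP hP₁ hR hP₂ hP₂₁ hR₂ hZ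
  have e1 : a - b = -(b - a) := by ring
  have e2 : b - c = -(c - b) := by ring
  rw [e1, div_neg] at hU₁
  rw [e2, div_neg] at hP₂
  subst hU hU₂ hY hU₁ hU₁₂ hY₁ hW hP hP₁ hR hP₂ hP₂₁ hR₂ hZ
  field_simp
  ring

theorem swap_braid {k : ℕ} (i : Fin k) (F : V (k + 2)) :
    swap (k + 1) i.castSucc (swap (k + 1) i.succ (swap (k + 1) i.castSucc F)) =
      swap (k + 1) i.succ (swap (k + 1) i.castSucc (swap (k + 1) i.succ F)) := by
  have h : (swap (k + 1) i.castSucc).comp ((swap (k + 1) i.succ).comp (swap (k + 1) i.castSucc)) =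
      (swap (k + 1) i.succ).comp ((swap (k + 1) i.castSucc).comp (swap (k + 1) i.succ)) := by
    refine algHom_ext_V (fun n => ?_) fun l => ?_
    · simp only [AlgHom.comp_apply, swap_ofSym_p]
    · simp only [AlgHom.comp_apply, swap_yVar]
      congr 1
      have e1 := Equiv.swap_mul_swap_mul_swap (x := i.castSucc.castSucc) (y := i.castSucc.succ)
        (z := i.succ.succ) (by simp [Fin.ext_iff]) (by simp [Fin.ext_iff]; omega)
      have e2 := Equiv.swap_mul_swap_mul_swap (x := i.succ.succ) (y := i.castSucc.succ)
        (z := i.castSucc.castSucc) (by simp [Fin.ext_iff]) (by simp [Fin.ext_iff]; omega)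
      rw [Equiv.swap_comm i.castSucc.succ i.castSucc.castSucc,
        Equiv.swap_comm i.succ.succ i.castSucc.succ,
        Equiv.swap_comm i.castSucc.castSucc i.succ.succ, ← e1] at e2
      rw [Fin.castSucc_succ]
      exact DFunLike.congr_fun e2 l
  exact DFunLike.congr_fun h F

theorem hecke_braid (k : ℕ) (i : Fin k) (F : V (k + 2)) :
    hecke (k + 1) i.castSucc (hecke (k + 1) i.succ (hecke (k + 1) i.castSucc F)) =
      hecke (k + 1) i.succ (hecke (k + 1) i.castSucc (hecke (k + 1) i.succ F)) := by
  have a1 : swap (k + 1) i.castSucc (yVar i.succ.succ) = yVar i.succ.succ :=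
    swap_yVar_of_ne (by simp [Fin.ext_iff]; omega) (by simp [Fin.ext_iff])
  have a2 : swap (k + 1) i.succ (yVar i.castSucc.castSucc) = yVar i.castSucc.castSucc :=
    swap_yVar_of_ne (by simp [Fin.ext_iff]) (by simp [Fin.ext_iff]; omega)
  have b1 := swap_yVar_castSucc (k + 1) i.castSucc
  have b2 := swap_yVar_succ (k + 1) i.castSucc
  have b3 := swap_yVar_castSucc (k + 1) i.succ
  have b4 := swap_yVar_succ (k + 1) i.succ
  have d1 := heckeDen_mul_hecke' (k + 1) i.castSucc
  have d2 := heckeDen_mul_hecke' (k + 1) i.succ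
  rw [Fin.castSucc_succ] at b3 b4 d2
  set a : V (k + 2) := yVar i.castSucc.castSucc
  set b : V (k + 2) := yVar i.castSucc.succ
  set c : V (k + 2) := yVar i.succ.succ
  set s₁ := swap (k + 1) i.castSucc with hs₁
  set s₂ := swap (k + 1) i.succ with hs₂
  have hinj := IsFractionRing.injective (V (k + 2)) (FractionRing (V (k + 2)))
  have hq : ∀ s : V (k + 2) →ₐ[Qqt] V (k + 2), s (MvPolynomial.C q) = MvPolynomial.C q := fun s =>
    s.commutes q
  have ne : ∀ i j : Fin (k + 2), i ≠ j → algebraMap (V (k + 2)) (FractionRing (V (k + 2))) (yVar i) -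
      algebraMap (V (k + 2)) (FractionRing (V (k + 2))) (yVar j) ≠ 0 := fun i j hij => by
    rw [sub_ne_zero]
    exact fun h => hij (Sum.inr_injective (MvPolynomial.X_injective (hinj h)))
  have m : ∀ {x₁ x₂ x₃ x₄ x₅ x₆ x₇ : V (k + 2)}, (x₁ - x₂) * x₃ =
      (MvPolynomial.C q - 1) * x₄ * x₅ + (x₆ - MvPolynomial.C q * x₄) * x₇ → _ :=
    fun h => congrArg (algebraMap (V (k + 2)) (FractionRing (V (k + 2)))) h
  simp only [map_mul, map_add, map_sub, map_one] at m
  have c₁ : ∀ {x₁ x₂ x₃ x₄ x₅ x₆ x₇ : V (k + 2)}, (x₁ - x₂) * x₃ =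
      (MvPolynomial.C q - 1) * x₄ * x₅ + (x₆ - MvPolynomial.C q * x₄) * x₇ → _ :=
    fun h => congrArg s₁ h
  have c₂ : ∀ {x₁ x₂ x₃ x₄ x₅ x₆ x₇ : V (k + 2)}, (x₁ - x₂) * x₃ =
      (MvPolynomial.C q - 1) * x₄ * x₅ + (x₆ - MvPolynomial.C q * x₄) * x₇ → _ :=
    fun h => congrArg s₂ h
  simp only [map_mul, map_add, map_sub, map_one, hq] at c₁ c₂
  set T₁ := hecke (k + 1) i.castSucc
  set T₂ := hecke (k + 1) i.succ
  have u := d1 F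
  have u₂ := c₂ u
  rw [b3, a2] at u₂
  have y := d2 (T₁ F)
  have u₁ := c₁ u
  rw [b1, b2, hs₁, swap_swap, ← hs₁] at u₁
  have u₁₂ := c₁ u₂
  rw [b1, a1] at u₁₂
  have y₁ := c₁ y
  rw [b2, a1] at y₁
  have w := d1 (T₂ (T₁ F))
  have p := d2 F
  have p₁ := c₁ p
  rw [b2, a1] at p₁
  have r := d1 (T₂ F)
  have p₂ := c₂ p
  rw [b3, b4, hs₂, swap_swap, ← hs₂] at p₂
  have p₂₁ := c₂ p₁
  -- The longest translate is normalised to $s_1s_2s_1F$, the form used by the other word.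
  rw [b4, a2, hs₁, hs₂, ← swap_braid, ← hs₁, ← hs₂] at p₂₁
  have r₂ := c₂ r
  rw [b3, a2] at r₂
  have z := d2 (T₁ (T₂ F))
  refine hinj (braid_of_den_mul (ne _ _ ?_) (ne _ _ ?_) (ne _ _ ?_) (m u) (m u₂) (m y) (m u₁)
    (m u₁₂) (m y₁) (m w) (m p) (m p₁) (m r) (m p₂) (m p₂₁) (m r₂) (m z))
  all_goals simp [Fin.ext_iff]
  omega

end Hecke

/-! ### Relations between `T_i`, `d₋` and the substitutions -/

section Relations

theorem swap_ofSym (k : ℕ) (i : Fin k) (F : Sym) :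
    swap k i (ofSym (k + 1) F) = ofSym (k + 1) F := by
  have h : (swap k i).comp (ofSym (k + 1)) = ofSym (k + 1) :=
    MvPolynomial.algHom_ext fun n => swap_ofSym_p k i n
  exact DFunLike.congr_fun h F

theorem swap_castSucc_yVar_last (k : ℕ) (i : Fin k) :
    swap (k + 1) i.castSucc (yVar (Fin.last (k + 1))) = yVar (Fin.last (k + 1)) :=
  swap_yVar_of_ne (Fin.castSucc_lt_last _).ne'
    (by rw [← Fin.castSucc_succ]; exact (Fin.castSucc_lt_last _).ne')

theorem swap_shiftPlus_shiftPlus (k : ℕ) (F : V k) :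
    swap (k + 1) (Fin.last k) (shiftPlus (k + 1) (shiftPlus k F)) =
      shiftPlus (k + 1) (shiftPlus k F) := by
  have h : (swap (k + 1) (Fin.last k)).comp ((shiftPlus (k + 1)).comp (shiftPlus k)) =
      (shiftPlus (k + 1)).comp (shiftPlus k) := by
    refine algHom_ext_V (fun n => ?_) fun j => ?_
    · simp only [AlgHom.comp_apply, swap_ofSym_p, shiftPlus_ofSym_p, shiftPlus_yVar, map_add,
        map_smul, map_pow, swap_yVar_castSucc]
      rw [← Fin.succ_last, swap_yVar_succ]
      abel
    · simp only [AlgHom.comp_apply, shiftPlus_yVar]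
      exact swap_yVar_of_ne (by simp [Fin.ext_iff]; omega) (by simp [Fin.ext_iff]; omega)
  exact DFunLike.congr_fun h F

theorem dMinus_hecke (k : ℕ) (i : Fin k) (F : V (k + 2)) :
    dMinus (k + 1) (hecke (k + 1) i.castSucc F) = hecke k i (dMinus (k + 1) F) := by
  induction F using V_induction with
  | add F G hF hG => rw [map_add, map_add, map_add, map_add, hF, hG]
  | mul j G =>
    rw [hecke_mul_of_symm (by rw [map_pow, swap_castSucc_yVar_last]), ← shiftPlus_hecke,
      dMinus_pow_mul_shiftPlus, dMinus_pow_mul_shiftPlus, hecke_mul_of_symm (swap_ofSym _ _ _)]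

/-- Both sides have the same initial value and satisfy the same two-term recursion,
`shiftPlus_h_succ`. -/
theorem dMinus_hecke_pow (k j : ℕ) :
    dMinus (k + 1) (hecke (k + 1) (Fin.last k) (yVar (Fin.last k).castSucc ^ j)) =
      shiftPlus k (ofSym k (h j)) := by
  induction j with
  | zero =>
    have h1 := dMinus_shiftPlus (k + 1) 1
    rw [map_one (shiftPlus (k + 1))] at h1
    rw [pow_zero, hecke_one, h_zero, map_one (ofSym k), map_one (shiftPlus k), h1]
  | succ j ih =>
    have h1 := shiftPlus_h_succ k j
    rw [pow_succ', hecke_yVar_castSucc_mul, map_add, dMinus_yVar_mul, ih, map_pow,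
      swap_yVar_castSucc, sub_mul, ← pow_succ', smul_mul_assoc, map_sub, map_smul, dMinus_yVar_mul,
      Fin.succ_last, dMinus_pow, dMinus_pow, ← smul_mul_assoc, ← h1]
    ring

/-- Elements shifted twice are symmetric in the last two variables, so they pull out of $T$ and then
out of $d_-$, leaving the case of a power. -/
theorem dMinus_hecke_shiftPlus (k : ℕ) (F : V (k + 1)) :
    dMinus (k + 1) (hecke (k + 1) (Fin.last k) (shiftPlus (k + 1) F)) =
      shiftPlus k (dMinus k F) := by
  induction F using V_induction with
  | add F G hF hG => simp only [map_add, hF, hG]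
  | mul j G =>
    rw [map_mul, map_pow, shiftPlus_yVar, mul_comm, hecke_mul_of_symm (swap_shiftPlus_shiftPlus k G),
      dMinus_shiftPlus_mul, dMinus_hecke_pow, dMinus_pow_mul_shiftPlus, map_mul, mul_comm]

/-- Evaluated on $y_{k+2}^jy_{k+1}^i$, the map gives $h_ih_{j+1}-h_{i+1}h_j$, which changes sign
when $i$ and $j$ are exchanged. -/
theorem dMinus_dMinus_antisymm (k : ℕ) (F : V (k + 2)) :
    dMinus k (dMinus (k + 1) ((yVar (Fin.last k).succ - q • yVar (Fin.last k).castSucc) *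
      swap (k + 1) (Fin.last k) F)) =
    -dMinus k (dMinus (k + 1) ((yVar (Fin.last k).succ - q • yVar (Fin.last k).castSucc) * F)) := by
  have key : ∀ (i j : ℕ) (G : V k), dMinus k (dMinus (k + 1)
      ((yVar (Fin.last k).succ - q • yVar (Fin.last k).castSucc) *
        (yVar (Fin.last k).succ ^ j * (yVar (Fin.last k).castSucc ^ i *
          shiftPlus (k + 1) (shiftPlus k G))))) =
      G * (ofSym k (h i) * ofSym k (h (j + 1)) - ofSym k (h (i + 1)) * ofSym k (h j)) := by
    intro i j G
    have h1 := shiftPlus_h_succ k j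
    have e1 : (yVar (Fin.last k).succ - q • yVar (Fin.last k).castSucc) *
        (yVar (Fin.last k).succ ^ j * (yVar (Fin.last k).castSucc ^ i *
          shiftPlus (k + 1) (shiftPlus k G))) =
        yVar (Fin.last (k + 1)) ^ (j + 1) *
          shiftPlus (k + 1) (yVar (Fin.last k) ^ i * shiftPlus k G) -
        yVar (Fin.last (k + 1)) ^ j *
          shiftPlus (k + 1) (q • (yVar (Fin.last k) ^ (i + 1) * shiftPlus k G)) := by
      rw [map_smul]
      simp only [map_mul, map_pow, shiftPlus_yVar, Fin.succ_last, Algebra.smul_def]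
      ring
    have e2 : ofSym (k + 1) (h (j + 1)) * (yVar (Fin.last k) ^ i * shiftPlus k G) -
        ofSym (k + 1) (h j) * q • (yVar (Fin.last k) ^ (i + 1) * shiftPlus k G) =
        yVar (Fin.last k) ^ i * shiftPlus k (ofSym k (h (j + 1)) * G) -
        yVar (Fin.last k) ^ (i + 1) * shiftPlus k (ofSym k (h j) * G) := by
      simp only [map_mul, Algebra.smul_def] at h1 ⊢
      linear_combination (-(yVar (Fin.last k) ^ i * shiftPlus k G)) * h1
    rw [e1, map_sub, dMinus_pow_mul_shiftPlus, dMinus_pow_mul_shiftPlus, e2, map_sub,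
      dMinus_pow_mul_shiftPlus, dMinus_pow_mul_shiftPlus]
    ring
  induction F using V_induction with
  | add F G hF hG => simp only [map_add, mul_add, hF, hG, neg_add]
  | mul j G =>
    induction G using V_induction with
    | add F G hF hG => simp only [map_add, mul_add, hF, hG, neg_add]
    | mul i G =>
      rw [map_mul (shiftPlus (k + 1)), map_pow (shiftPlus (k + 1)), shiftPlus_yVar, ← Fin.succ_last,
        map_mul (swap (k + 1) (Fin.last k)), map_mul (swap (k + 1) (Fin.last k)),
        map_pow (swap (k + 1) (Fin.last k)), map_pow (swap (k + 1) (Fin.last k)), swap_yVar_succ,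
        swap_yVar_castSucc, swap_shiftPlus_shiftPlus, key, mul_left_comm (yVar _ ^ j), key]
      ring

/-- $F-TF$ is $y_{k+2}-qy_{k+1}$ times the divided difference $N$ of $F$. As $N$ is symmetric, the
antisymmetry above makes $d_-^2$ kill this product. -/
theorem dMinus_dMinus_hecke (k : ℕ) (F : V (k + 2)) :
    dMinus k (dMinus (k + 1) (hecke (k + 1) (Fin.last k) F)) = dMinus k (dMinus (k + 1) F) := by
  obtain ⟨N, hN⟩ := heckeDen_dvd_sub (k + 1) (Fin.last k) F
  have hs : swap (k + 1) (Fin.last k) N = N := by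
    have h1 := congrArg (swap (k + 1) (Fin.last k)) hN
    rw [map_sub, swap_swap, map_mul, heckeDen, map_sub, swap_yVar_succ, swap_yVar_castSucc] at h1
    apply mul_left_cancel₀ (heckeDen_ne_zero (k + 1) (Fin.last k))
    rw [← hN, heckeDen]
    linear_combination h1
  have hT : hecke (k + 1) (Fin.last k) F =
      F - (yVar (Fin.last k).succ - q • yVar (Fin.last k).castSucc) * N := by
    rw [hecke_eq_iff]
    rw [heckeDen] at hN
    simp only [Algebra.smul_def, MvPolynomial.algebraMap_eq]
    linear_combination (yVar (Fin.last k).succ -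
      MvPolynomial.C q * yVar (Fin.last k).castSucc) * hN
  have h0 := dMinus_dMinus_antisymm k N
  rw [hs, eq_neg_iff_add_eq_zero, ← two_smul Qqt, smul_eq_zero_iff_right two_ne_zero] at h0
  rw [hT, map_sub, map_sub, h0, sub_zero]

theorem hecke_yVar_succ_mul_hecke (k : ℕ) (i : Fin k) (F : V (k + 1)) :
    hecke k i (yVar i.succ * hecke k i F) = q • (yVar i.castSucc * F) := by
  rw [hecke_yVar_succ_mul, hecke_hecke]
  simp only [Algebra.smul_def, map_sub, map_one]
  ring

end Relations

/-! ### Words in the operators `T_i` -/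

section Words

/-- The word `T₁ ⋯ T_k` on `V (k + 1)`. -/
def up (k : ℕ) : Module.End Qqt (V (k + 1)) := (List.ofFn (hecke k)).prod

/-- The word `T₁ ⋯ T_k` on `V (k + 2)`. -/
def upInit (k : ℕ) : Module.End Qqt (V (k + 2)) :=
  (List.ofFn fun i : Fin k => hecke (k + 1) i.castSucc).prod

/-- The word `T₂ ⋯ T_{k + 1}` on `V (k + 2)`. -/
def upTail (k : ℕ) : Module.End Qqt (V (k + 2)) :=
  (List.ofFn fun i : Fin k => hecke (k + 1) i.succ).prod

theorem up_succ (k : ℕ) (F : V (k + 2)) :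
    up (k + 1) F = upInit k (hecke (k + 1) (Fin.last k) F) := by
  rw [up, List.ofFn_succ', List.concat_eq_append, List.prod_append, List.prod_singleton]
  rfl

theorem up_succ' (k : ℕ) (F : V (k + 2)) : up (k + 1) F = hecke (k + 1) 0 (upTail k F) := by
  rw [up, List.ofFn_succ, List.prod_cons]
  rfl

theorem hecke_braid_mul (k : ℕ) (i : Fin k) :
    hecke (k + 1) i.castSucc * hecke (k + 1) i.succ * hecke (k + 1) i.castSucc =
      hecke (k + 1) i.succ * hecke (k + 1) i.castSucc * hecke (k + 1) i.succ :=
  LinearMap.ext (hecke_braid k i)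

theorem hecke_comm_mul (k : ℕ) (i j : Fin k) (h : (i : ℕ) + 1 < j) :
    hecke k i * hecke k j = hecke k j * hecke k i :=
  LinearMap.ext fun F => hecke_comm h F

theorem up_hecke (k : ℕ) (i : Fin k) (F : V (k + 2)) :
    up (k + 1) (hecke (k + 1) i.castSucc F) = hecke (k + 1) i.succ (up (k + 1) F) :=
  DFunLike.congr_fun
    (prod_ofFn_mul_of_braid (hecke (k + 1)) (hecke_braid_mul k) (hecke_comm_mul (k + 1)) i) F

theorem hecke_up_upInit (k : ℕ) (F : V (k + 2)) :
    hecke (k + 1) 0 (up (k + 1) (upInit k F)) = up (k + 1) (up (k + 1) F) :=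
  DFunLike.congr_fun
    (mul_prod_ofFn_mul_of_braid (hecke (k + 1)) (hecke_braid_mul k) (hecke_comm_mul (k + 1))) F

theorem dMinus_upInit (k : ℕ) (F : V (k + 2)) :
    dMinus (k + 1) (upInit k F) = up k (dMinus (k + 1) F) :=
  map_prod_ofFn (dMinus (k + 1)) _ _ (dMinus_hecke k) F

theorem upInit_yVar_last_mul (k : ℕ) (F : V (k + 2)) :
    yVar (Fin.last (k + 1)) * upInit k F = upInit k (yVar (Fin.last (k + 1)) * F) :=
  map_prod_ofFn (LinearMap.mulLeft Qqt (yVar (Fin.last (k + 1)))) _ _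
    (fun i _ => (hecke_mul_of_symm (swap_castSucc_yVar_last k i) _).symm) F

theorem shiftPlus_up (k : ℕ) (F : V (k + 1)) :
    shiftPlus (k + 1) (up k F) = upInit k (shiftPlus (k + 1) F) :=
  map_prod_ofFn (shiftPlus (k + 1)).toLinearMap _ _ (shiftPlus_hecke k) F

theorem dPlus_apply (k : ℕ) (F : V k) :
    dPlus k F = -up k (yVar (Fin.last k) * shiftPlus k F) := rfl

/-- Moving $y_{k+2}$ out of the last $T$ splits $d_-d_+F$ into a term equal to $d_+d_-F$ and a
remainder. -/
theorem bracket_dPlus (k : ℕ) (F : V (k + 1)) :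
    bracket dMinus dPlus k F = (q - 1) • up k (yVar (Fin.last k) * F) := by
  rw [bracket_apply, dPlus_apply, dPlus_apply, map_neg, up_succ, dMinus_upInit, ← Fin.succ_last,
    hecke_yVar_succ_mul, dMinus_yVar_mul, map_add, map_smul, dMinus_hecke_shiftPlus,
    dMinus_shiftPlus, mul_add, map_add, mul_smul_comm, map_smul]
  abel

end Words

/-! ### The basic actions -/

section Basic

/-- The first basic action. -/
def firstRep : Rep V q where
  T := hecke
  dm := dMinus
  dp := dPlus
  u_ne_zero := q_ne_zero
  u_ne_one := q_ne_one
  hecke := hecke_hecke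
  braid := hecke_braid_mul
  comm := hecke_comm_mul
  dm_dm_T := dMinus_dMinus_hecke
  dm_T := dMinus_hecke
  T_dp_dp k F := by
    -- By `hecke_up_upInit` a leading $T_1$ in front of $d_+^2$ becomes a $T_{k+1}$ at the far end,
    -- acting on this symmetric expression and hence trivially.
    have h1 : swap (k + 1) (Fin.last k) (yVar (Fin.last (k + 1)) * (yVar (Fin.last k).castSucc *
        shiftPlus (k + 1) (shiftPlus k F))) = yVar (Fin.last (k + 1)) *
        (yVar (Fin.last k).castSucc * shiftPlus (k + 1) (shiftPlus k F)) := by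
      rw [← Fin.succ_last, map_mul, map_mul, swap_yVar_succ, swap_yVar_castSucc,
        swap_shiftPlus_shiftPlus, mul_left_comm]
    rw [dPlus_apply, dPlus_apply, map_neg, map_neg, shiftPlus_up, map_mul (shiftPlus (k + 1)),
      shiftPlus_yVar, mul_neg,
      map_neg, upInit_yVar_last_mul, map_neg, hecke_up_upInit, up_succ k (_ * _),
      hecke_of_symm h1]
  dp_T k i F := by
    rw [dPlus_apply, dPlus_apply, shiftPlus_hecke, ← hecke_mul_of_symm (swap_castSucc_yVar_last k i),
      up_hecke, map_neg]
  dm_bracket k F := by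
    rw [bracket_dPlus, bracket_dPlus, map_smul, up_succ, dMinus_upInit, ← Fin.succ_last,
      hecke_yVar_succ_mul_hecke, map_smul, map_smul, dMinus_yVar_mul, smul_comm]
  bracket_dp k F := by
    have h1 : hecke (k + 1) (Fin.last k) (yVar (Fin.last k).succ * hecke (k + 1) (Fin.last k)
        (yVar (Fin.last k).succ * shiftPlus (k + 1) F)) =
        q • (yVar (Fin.last k).succ * (yVar (Fin.last k).castSucc * shiftPlus (k + 1) F)) := by
      rw [hecke_yVar_succ_mul_hecke, mul_left_comm]
    rw [bracket_dPlus, bracket_dPlus, dPlus_apply, dPlus_apply, map_smul, mul_neg, map_neg, map_smul,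
      map_neg, up_succ k (_ * shiftPlus _ _), upInit_yVar_last_mul, hecke_up_upInit,
      up_succ k (_ * hecke _ _ _), ← Fin.succ_last, h1, shiftPlus_up, map_smul, map_smul, mul_smul_comm,
      Fin.succ_last, upInit_yVar_last_mul, map_smul, map_mul (shiftPlus (k + 1)), shiftPlus_yVar, smul_neg,
      smul_neg,
      smul_comm]

/-- Induction on the power of the last variable: both sides vanish on shifted elements, and
`bracketStar_yVar_last_mul` gives both the same recursion. -/
theorem dMinus_bracketStar (k : ℕ) (F : V (k + 2)) :
    q • dMinus (k + 1) (bracket dMinus dPlusStar (k + 1) F) =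
      bracket dMinus dPlusStar k (dMinus (k + 1) (hecke (k + 1) (Fin.last k) F)) := by
  induction F using V_induction' with
  | add F G hF hG => simp only [map_add, smul_add, hF, hG]
  | base G =>
    rw [bracketStar_shiftPlus, dMinus_hecke_shiftPlus, bracketStar_shiftPlus, map_zero, smul_zero]
  | mul F ih =>
    have e0 := dMinus_yVar_mul (k + 1) 0
    rw [Fin.castSucc_zero] at e0
    have e1 := dMinus_dMinus_hecke k F
    rw [bracketStar_yVar_last_mul, smul_mul_assoc, map_smul, e0, ← Fin.succ_last,
      hecke_yVar_succ_mul, dMinus_yVar_mul, bracketStar_yVar_last_mul]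
    simp only [map_add, map_smul, bracket_apply, map_sub, e1] at ih ⊢
    simp only [Algebra.smul_def, map_sub, map_one] at ih ⊢
    linear_combination (algebraMap Qqt (V (k + 1)) q * algebraMap Qqt (V (k + 1)) t * yVar 0) * ih

theorem hecke_dStar_dStar (k : ℕ) (F : V k) :
    hecke (k + 1) 0 (dStar (k + 1) (dStar k F)) = dStar (k + 1) (dStar k F) := by
  refine hecke_of_symm ?_
  have h : (swap (k + 1) 0).comp ((dStar (k + 1)).comp (dStar k)) =
      (dStar (k + 1)).comp (dStar k) := by
    have e1 := swap_yVar_castSucc (k + 1) 0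
    have e2 := swap_yVar_succ (k + 1) 0
    rw [Fin.castSucc_zero] at e1 e2
    refine algHom_ext_V (fun n => ?_) fun j => ?_
    · simp only [AlgHom.comp_apply, swap_ofSym_p, dStar_ofSym_p, dStar_yVar, map_add,
        map_smul, map_pow, e1, e2]
      abel
    · simp only [AlgHom.comp_apply, dStar_yVar]
      exact swap_yVar_of_ne (by simp [Fin.ext_iff]) (by simp [Fin.ext_iff])
  exact DFunLike.congr_fun h F

theorem bracketStar_dPlusStar (k : ℕ) (F : V (k + 1)) :
    q • bracket dMinus dPlusStar (k + 1) (dPlusStar (k + 1) F) =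
      hecke (k + 1) 0 (dPlusStar (k + 1) (bracket dMinus dPlusStar k F)) := by
  induction F using V_induction' with
  | add F G hF hG => simp only [map_add, smul_add, hF, hG]
  | base G =>
    rw [bracketStar_shiftPlus, dPlusStar_apply, dStar_shiftPlus, bracketStar_shiftPlus, smul_zero,
      map_zero, map_zero]
  | mul F ih =>
    have e0 := hecke_yVar_succ_mul (k + 1) 0
    rw [Fin.castSucc_zero] at e0
    have e1 := hecke_dStar_dStar k (dMinus k F)
    rw [bracketStar_yVar_last_mul, dPlusStar_apply, dPlusStar_apply, map_mul (dStar (k + 1)),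
      map_mul (dStar (k + 1)), dStar_yVar, Fin.succ_last, bracketStar_yVar_last_mul, map_smul, dStar_yVar,
      smul_mul_assoc t (yVar (Fin.succ 0)), map_smul (hecke (k + 1) 0), e0]
    simp only [map_add, map_smul, bracket_apply, map_sub, dPlusStar_apply, e1] at ih ⊢
    simp only [Algebra.smul_def, map_sub, map_one] at ih ⊢
    linear_combination (algebraMap Qqt (V (k + 2)) q * algebraMap Qqt (V (k + 2)) t * yVar 0) * ih

/-- The second basic action. -/
def secondRep : Rep V q⁻¹ where
  T := firstRep.Tinv
  dm := dMinus
  dp := dPlusStar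
  u_ne_zero := inv_ne_zero q_ne_zero
  u_ne_one := inv_ne_one.2 q_ne_one
  -- The relations not involving $d_+^*$ are inherited from the twist of the first action.
  hecke := (firstRep.twist q_mul_q_inv).hecke
  braid := (firstRep.twist q_mul_q_inv).braid
  comm := (firstRep.twist q_mul_q_inv).comm
  dm_dm_T := (firstRep.twist q_mul_q_inv).dm_dm_T
  dm_T := (firstRep.twist q_mul_q_inv).dm_T
  T_dp_dp k F := by
    have h1 := firstRep.Tinv_T (k + 1) 0 (dStar (k + 1) (dStar k F))
    rwa [show firstRep.T = hecke from rfl, hecke_dStar_dStar] at h1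
  dp_T k i F := by
    rw [Rep.Tinv_apply, Rep.Tinv_apply, map_smul, map_add, map_smul]
    simp only [dPlusStar_apply, firstRep, dStar_hecke]
  dm_bracket k F := by
    have h1 := dMinus_bracketStar k (firstRep.Tinv (k + 1) (Fin.last k) F)
    have h2 := firstRep.T_Tinv (k + 1) (Fin.last k) F
    rw [show firstRep.T = hecke from rfl] at h2
    rw [h2] at h1
    rw [← h1, inv_smul_smul₀ q_ne_zero]
  bracket_dp k F := by
    have h2 := firstRep.Tinv_T (k + 1) 0 (dPlusStar (k + 1) (bracket dMinus dPlusStar k F))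
    rw [show firstRep.T = hecke from rfl, ← bracketStar_dPlusStar, map_smul] at h2
    rw [← h2, inv_smul_smul₀ q_ne_zero]

theorem prod_reverse_ofFn_mul_prod_ofFn {M : Type*} [Monoid M] : ∀ {n : ℕ} (f g : Fin n → M)
    (_ : ∀ i, g i * f i = 1), (List.ofFn g).reverse.prod * (List.ofFn f).prod = 1
  | 0, _, _, _ => by simp
  | n + 1, f, g, h => by
    rw [List.ofFn_succ, List.ofFn_succ, List.reverse_cons, List.prod_append, List.prod_cons,
      List.prod_cons, List.prod_nil, mul_one, mul_assoc, ← mul_assoc (g 0), h, one_mul]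
    exact prod_reverse_ofFn_mul_prod_ofFn _ _ fun i => h i.succ

theorem prod_ofFn_mul_prod_reverse_ofFn {M : Type*} [Monoid M] : ∀ {n : ℕ} (f g : Fin n → M)
    (_ : ∀ i, f i * g i = 1), (List.ofFn f).prod * (List.ofFn g).reverse.prod = 1
  | 0, _, _, _ => by simp
  | n + 1, f, g, h => by
    rw [List.ofFn_succ, List.ofFn_succ, List.reverse_cons, List.prod_append, List.prod_cons,
      List.prod_cons, List.prod_nil, mul_one, mul_assoc, ← mul_assoc _ _ (g 0),
      prod_ofFn_mul_prod_reverse_ofFn _ _ fun i => h i.succ, one_mul, h]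

theorem down_up (k : ℕ) (F : V (k + 1)) : secondRep.down k (up k F) = F :=
  DFunLike.congr_fun (prod_reverse_ofFn_mul_prod_ofFn (hecke k) (firstRep.Tinv k)
    (firstRep.Tinv_mul_T k)) F

theorem up_down (k : ℕ) (F : V (k + 1)) : up k (secondRep.down k F) = F :=
  DFunLike.congr_fun (prod_ofFn_mul_prod_reverse_ofFn (hecke k) (firstRep.Tinv k)
    (firstRep.T_mul_Tinv k)) F

/-- Collapses from the middle outwards, each pair of equal letters lowering the index of `m` by one
at the cost of a factor `c`. -/
theorem prod_ofFn_mul_mul_prod_reverse_ofFn {A : Type*} [Ring A] [Algebra Qqt A] (c : Qqt) :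
    ∀ {n : ℕ} (f : Fin n → A) (m : Fin (n + 1) → A)
    (_ : ∀ i, f i * m i.succ * f i = c • m i.castSucc),
    (List.ofFn f).prod * m (Fin.last n) * (List.ofFn f).reverse.prod = c ^ n • m 0
  | 0, _, _, _ => by simp
  | n + 1, f, m, h => by
    have h1 := h (Fin.last n)
    have ih := prod_ofFn_mul_mul_prod_reverse_ofFn c (fun i => f i.castSucc)
      (fun i => m i.castSucc) fun i => by rw [← Fin.succ_castSucc]; exact h _
    rw [Fin.castSucc_zero] at ih
    rw [List.ofFn_succ', List.concat_eq_append, List.reverse_append, List.prod_append,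
      List.prod_append, List.prod_singleton, List.reverse_singleton, List.prod_singleton,
      ← Fin.succ_last, pow_succ', mul_smul, ← ih]
    simp only [mul_assoc] at h1 ⊢
    rw [← mul_assoc (m _) (f _), ← mul_assoc (f _), h1]
    simp only [mul_smul_comm, smul_mul_assoc]

theorem firstRep_y_zero (k : ℕ) (F : V (k + 1)) : firstRep.y k 0 F = yVar 0 * F := by
  have h1 : firstRep.φ k (firstRep.down k F) =
      (q - 1) • up k (yVar (Fin.last k) * firstRep.down k F) := bracket_dPlus k _
  have h2 := DFunLike.congr_fun (prod_ofFn_mul_mul_prod_reverse_ofFn q (hecke k)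
    (fun i => LinearMap.mulLeft Qqt (yVar i)) fun i =>
      LinearMap.ext (hecke_yVar_succ_mul_hecke k i)) F
  have h3 : up k (yVar (Fin.last k) * firstRep.down k F) = q ^ k • (yVar 0 * F) := h2
  rw [Rep.y_zero_apply, h1, h3, smul_smul (q - 1), mul_comm (q - 1),
    inv_smul_smul₀ (firstRep.scalar_ne_zero k)]

theorem firstRep_y_one (k : ℕ) (F : V (k + 2)) : firstRep.y (k + 1) 1 F = yVar 1 * F := by
  have h1 := hecke_yVar_succ_mul_hecke (k + 1) 0 (firstRep.Tinv (k + 1) 0 F)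
  have h2 := firstRep.T_Tinv (k + 1) 0 F
  rw [show firstRep.T = hecke from rfl] at h2
  rw [h2, Fin.castSucc_zero] at h1
  rw [← Fin.succ_zero_eq_one, Rep.y_succ_apply, Fin.castSucc_zero, firstRep_y_zero, ← map_smul, ← h1]
  exact firstRep.Tinv_T (k + 1) 0 _

/-- The descending word of the second action is inverse to $T_1\cdots T_k$. Precomposing with the
latter strips it off and removes all inverses from later computations. -/
theorem secondRep_y_zero_up (k : ℕ) (F : V (k + 1)) : secondRep.y k 0 (up k F) =
    (q⁻¹ ^ k * (q⁻¹ - 1))⁻¹ • bracket dMinus dPlusStar k F := by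
  rw [Rep.y_zero_apply, down_up]
  rfl

theorem bracketStar_hecke (k : ℕ) (i : Fin k) (F : V (k + 2)) :
    bracket dMinus dPlusStar (k + 1) (hecke (k + 1) i.castSucc F) =
      hecke (k + 1) i.succ (bracket dMinus dPlusStar (k + 1) F) := by
  simp only [bracket_apply, dPlusStar_apply, dMinus_hecke, dStar_hecke, map_sub]
  rw [← dMinus_hecke, Fin.castSucc_succ]

theorem bracketStar_upInit (k : ℕ) (F : V (k + 2)) :
    bracket dMinus dPlusStar (k + 1) (upInit k F) =
      upTail k (bracket dMinus dPlusStar (k + 1) F) :=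
  map_prod_ofFn _ _ _ (bracketStar_hecke k) F

theorem bracketStar_hecke_shiftPlus (k : ℕ) (F : V (k + 1)) :
    bracket dMinus dPlusStar (k + 1) (hecke (k + 1) (Fin.last k) (shiftPlus (k + 1) F)) =
      shiftPlus (k + 1) (bracket dMinus dPlusStar k F) := by
  rw [bracket_apply, dMinus_hecke_shiftPlus, dPlusStar_apply, dPlusStar_apply, dStar_shiftPlus,
    dStar_hecke, dStar_shiftPlus, Fin.succ_last, dMinus_hecke_shiftPlus, bracket_apply, map_sub,
    dPlusStar_apply, dPlusStar_apply]

theorem dPlus_secondRep_y_zero (k : ℕ) (F : V (k + 1)) :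
    dPlus (k + 1) (secondRep.y k 0 F) = secondRep.y (k + 1) 1 (dPlus (k + 1) F) := by
  obtain ⟨G, rfl⟩ : ∃ G, F = up k G := ⟨_, (up_down k F).symm⟩
  have hq := q_ne_zero
  have hTinv : ∀ H, secondRep.Tinv (k + 1) 0 H = hecke (k + 1) 0 H := fun H => by
    rw [Rep.Tinv_eq_of_T_eq_Tinv (R := firstRep) (S := secondRep) rfl]
    rfl
  -- Moving $y_{k+2}$ through $T$ turns it into $y_{k+1}$, which the bracket raises back; the extra
  -- term dies because the bracket vanishes on shifted elements.
  have h1 : bracket dMinus dPlusStar (k + 1) (hecke (k + 1) (Fin.last k)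
      (yVar (Fin.last (k + 1)) * shiftPlus (k + 1) G)) =
      yVar (Fin.last (k + 1)) * shiftPlus (k + 1) (bracket dMinus dPlusStar k G) := by
    rw [← Fin.succ_last, hecke_yVar_succ_mul, bracketStar_yVar_mul, map_add, map_smul,
      bracketStar_shiftPlus, bracketStar_hecke_shiftPlus, smul_zero, add_zero]
  rw [secondRep_y_zero_up, map_smul, dPlus_apply, ← h1, ← Fin.succ_zero_eq_one, Rep.y_succ_apply,
    hTinv, hTinv, Fin.castSucc_zero, dPlus_apply, shiftPlus_up, upInit_yVar_last_mul, map_neg,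
    map_neg, map_neg, hecke_up_upInit, secondRep_y_zero_up, map_smul, smul_neg, smul_neg, smul_smul,
    up_succ k (yVar _ * shiftPlus _ _), bracketStar_upInit, ← up_succ']
  congr 2
  have h2 : q⁻¹ - 1 ≠ 0 := sub_ne_zero.2 (inv_ne_one.2 q_ne_one)
  rw [pow_succ']
  field_simp

theorem basic_intertwined : Rep.Intertwined t firstRep secondRep where
  T_eq _ _ := rfl
  dm_eq _ := rfl
  dp_y k i F := by
    refine secondRep.map_y k (dPlus (k + 1)) (fun i F => ?_) (dPlus_secondRep_y_zero k) i F
    simp only [secondRep, Rep.Tinv_apply, map_smul, map_add]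
    rw [show dPlus (k + 1) (firstRep.T k i F) = _ from firstRep.dp_T k i F]
    rfl
  dp_y' k i F := by
    refine firstRep.map_y k (dPlusStar (k + 1)) (dStar_hecke k) (fun F => ?_) i F
    rw [firstRep_y_zero, firstRep_y_one, dPlusStar_apply, dPlusStar_apply, map_mul, dStar_yVar]
    rfl
  z_dp k F := by
    have hq := q_ne_zero
    have h2 : q⁻¹ - 1 ≠ 0 := sub_ne_zero.2 (inv_ne_one.2 q_ne_one)
    have h3 : q - 1 ≠ 0 := sub_ne_zero.2 q_ne_one
    change secondRep.y k 0 (dPlus k F) = _ • firstRep.y k 0 (dPlusStar k F)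
    -- Only the term $(1-q)ty_1d_-d_+^*$ of the recursion survives on a shifted element. Its factor
    -- $1-q$ and the normalisation of $z_1$ combine to $q^{k+1}$.
    rw [firstRep_y_zero, dPlus_apply, map_neg, secondRep_y_zero_up, bracketStar_yVar_last_mul,
      bracketStar_shiftPlus, zero_add, dPlusStar_apply, dPlusStar_apply, dStar_shiftPlus,
      dMinus_shiftPlus, mul_smul_comm, smul_mul_assoc, smul_smul, smul_smul, ← neg_smul]
    congr 1
    have h4 : q⁻¹ - 1 = -(q⁻¹ * (q - 1)) := by field_simp; ring
    rw [h4, inv_pow, pow_succ]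
    field_simp
    ring

/-- The pair of basic actions. -/
def basicPair : IntertwinedPair := ⟨firstRep, secondRep, basic_intertwined⟩

theorem isFirstBasic_firstRep : IsFirstBasic (firstRep.toAction algebraMap_q₀) :=
  ⟨firstRep.toAction_T _, firstRep.toAction_dMinus _, firstRep.toAction_dPlus _⟩

theorem isSecondBasic_secondRep : IsSecondBasic (secondRep.toAction algebraMap_q₀_inv) := by
  refine ⟨fun k i => ?_, secondRep.toAction_dMinus _, secondRep.toAction_dPlus _⟩
  rw [Rep.toAction_T, homogeneous_mul, homogeneous_mul]
  exact ⟨congrArg homogeneous (firstRep.Tinv_mul_T k i),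
    congrArg homogeneous (firstRep.T_mul_Tinv k i)⟩

end Basic

end

end DyckPathAlgebra

theorem mainTheorem4 :
    ∃ (ρ : ∀ m n : ℕ, Nat.Coprime m n → DyckPathAlgebra.Action DyckPathAlgebra.q₀)
      (ρs : ∀ m n : ℕ, Nat.Coprime m n → DyckPathAlgebra.Action DyckPathAlgebra.q₀⁻¹),
      DyckPathAlgebra.IsFirstBasic (ρ 0 1 (Nat.coprime_one_right 0)) ∧
      DyckPathAlgebra.IsSecondBasic (ρs 1 0 (Nat.coprime_one_left 0)) ∧
      (∀ (m n : ℕ) (h : Nat.Coprime m n),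
        DyckPathAlgebra.ShareTdMinus (ρ m n h) (ρs m n h) ∧
        ∀ k : ℕ, (ρ m n h).dPlus k = -DyckPathAlgebra.q ^ k • (ρs m n h).dPlus k) ∧
      (∀ (m n m' n' : ℕ) (h : Nat.Coprime m n) (h' : Nat.Coprime m' n')
        (h'' : Nat.Coprime (m + m') (n + n')),
        (m' : ℤ) * n - m * n' = 1 →
          DyckPathAlgebra.CorrectlyIntertwined (ρ m n h) (ρs m' n' h') ∧
          DyckPathAlgebra.IsReplication (ρ m n h) (ρs m' n' h')
            (ρ (m + m') (n + n') h'') (ρs (m + m') (n + n') h'')) := by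
  exact DyckPathAlgebra.exists_actions DyckPathAlgebra.basicPair
    DyckPathAlgebra.isFirstBasic_firstRep DyckPathAlgebra.isSecondBasic_secondRep
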